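/- Let $k$ be an algebraically closed field. All categories are $k$-linear, skeletal, have finitely many objects and finite-dimensional morphism spaces. Such a category $\mathcal C$ is *directed* with respect to a partial order $\leqslant$ on $\mathrm{Ob}\,\mathcal C$ if $\mathcal C(x,y)\neq 0$ implies $x\leqslant y$. It is a *graded directed category* if moreover $\mathcal C(x,y)=\bigoplus_{n\geqslant 0}\mathcal C(x,y)_n$ with $\mathcal C(y,z)_m\circ\mathcal C(x,y)_n\subseteq\mathcal C(x,z)_{m+n}$, all identities have degree $0$, and the degree zero part consists precisely of the endomorphisms: $\mathcal C(x,x)_0=\mathcal C(x,x)$, and $\mathcal C(x,y)_0=0$ for $x\neq y$. Let $A=\bigoplus_{x,y}\mathcal C(x,y)$ be the associated algebra (the product of $\beta$ and $\alpha$ is $\beta\circ\alpha$ if this is defined, and $0$ otherwise), graded by $A_n=\bigoplus_{x,y}\mathcal C(x,y)_n$; then $\mathcal C_0:=A_0=\bigoplus_x\mathcal C(x,x)$, and $\mathcal C$-modules are left $A$-modules. The graded category $\mathcal C$ is *Koszul* if $A_iA_j=A_{i+j}$ for all $i,j\geqslant 0$ and the graded $A$-module $A_0=A/\bigoplus_{i\geqslant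 1}A_i$ has a graded projective resolution $\cdots\to P^1\to P^0\to A_0\to 0$ in which every $P^i$ is locally finite and generated in degree $i$. The *Yoneda category* $E(\mathcal C_0)=\mathrm{Ext}^*_{\mathcal C}(\mathcal C_0,\mathcal C_0)$ of a graded directed category $\mathcal C$ has the same objects as $\mathcal C$, the graded morphism spaces $$E(\mathcal C_0)(x,y)=\bigoplus_{n\geqslant 0}\mathrm{Ext}^n_{\mathcal C}\big(\mathcal C(x,x),\mathcal C(y,y)\big),$$ where $\mathcal C(x,x)$ is regarded as a $\mathcal C$-module supported on $x$, and the Yoneda product as composition. **Theorem 5.10.** Let $\mathcal C$ be a graded directed category with respect to the partial order $\leqslant$. Suppose that $\mathcal C$ is Koszul and that the algebra $\mathcal C_0$ is self-injective (every finitely generated projective $\mathcal C_0$-module is injective). Then the Yoneda category $E(\mathcal C_0)$ is again a graded directed category, with respect to the same partial order $\leqslant$, and it is Koszul. -/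

import Mathlib

open CategoryTheory

universe u w

noncomputable section

namespace DirectedKoszul

section GradedAlgebra

variable {k : Type w} [Field k] {A : Type u} [Ring A] [Algebra k A]

/-- A `ℤ`-graded left module over the algebra `A` with grading `𝒜`:
`M = ⨁ᵢ Mᵢ` with `Aᵢ • Mⱼ ⊆ Mᵢ₊ⱼ`. -/
structure GrModule (𝒜 : ℕ → Submodule k A) where
  carrier : Type u
  [addCommGroup : AddCommGroup carrier]
  [moduleBase : Module k carrier]
  [module : Module A carrier]
  [isScalarTower : IsScalarTower k A carrier]
  deg : ℤ → Submodule k carrier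
  isInternal : DirectSum.IsInternal deg
  smul_mem : ∀ {i : ℕ} {j : ℤ} {a : A} {m : carrier},
    a ∈ 𝒜 i → m ∈ deg j → a • m ∈ deg (i + j)

attribute [instance] GrModule.addCommGroup GrModule.moduleBase GrModule.module
  GrModule.isScalarTower

variable {𝒜 : ℕ → Submodule k A}

/-- `M` is locally finite: every `Mᵢ` is finite-dimensional. -/
def GrModule.IsLocallyFinite (M : GrModule 𝒜) : Prop :=
  ∀ i, Module.Finite k (M.deg i)

/-- `M` is generated in degree `s`: `M = A · Mₛ`. -/
def GrModule.IsGeneratedIn (M : GrModule 𝒜) (s : ℤ) : Prop :=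
  Submodule.span A (M.deg s : Set M.carrier) = ⊤

/-- A homomorphism of modules `M → N` is graded (of degree `0`). -/
def GrModule.IsGradedHom {M N : GrModule 𝒜} (f : M.carrier →ₗ[A] N.carrier) : Prop :=
  ∀ i, ∀ m ∈ M.deg i, f m ∈ N.deg i

/-- A graded module is Koszul if it is generated in degree `0` and has a graded projective
resolution `⋯ → P¹ → P⁰ → M → 0` by locally finite modules such that `Pⁱ` is generated in
degree `i` for every `i`. -/
def GrModule.IsKoszul (M : GrModule 𝒜) : Prop :=
  M.IsLocallyFinite ∧ M.IsGeneratedIn 0 ∧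
  ∃ (P : ℕ → GrModule 𝒜)
    (d : ∀ i, (P (i + 1)).carrier →ₗ[A] (P i).carrier)
    (ε : (P 0).carrier →ₗ[A] M.carrier),
    (∀ i, Module.Projective A (P i).carrier) ∧
    (∀ i, (P i).IsLocallyFinite) ∧
    (∀ i : ℕ, (P i).IsGeneratedIn i) ∧
    (∀ i, GrModule.IsGradedHom (d i)) ∧
    GrModule.IsGradedHom ε ∧
    Function.Surjective ε ∧
    Function.Exact (d 0) ε ∧
    ∀ i, Function.Exact (d (i + 1)) (d i)

/-- The grading on a module which is concentrated in degree `0`. -/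
def concentrated (k : Type w) [Field k] (N : Type u) [AddCommGroup N] [Module k N] (i : ℤ) :
    Submodule k N :=
  if i = 0 then ⊤ else ⊥

theorem concentrated_isInternal (k : Type w) [Field k] (N : Type u) [AddCommGroup N]
    [Module k N] : DirectSum.IsInternal (concentrated k N) := by
  rw [DirectSum.isInternal_submodule_iff_iSupIndep_and_iSup_eq_top]
  constructor
  · intro i
    by_cases h : i = 0
    · refine disjoint_iff.mpr (le_bot_iff.mp (inf_le_right.trans ?_))
      exact iSup₂_le fun j hj => by
        rw [concentrated, if_neg fun h0 : j = 0 => hj (h0.trans h.symm)]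
    · simp [concentrated, h]
  · exact eq_top_iff.mpr (le_iSup_of_le 0 (by simp [concentrated]))

variable (𝒜) in
/-- The ideal `J = ⨁_{i ≥ 1} Aᵢ`. -/
def positiveIdeal [GradedAlgebra 𝒜] : Submodule A A :=
  (HomogeneousIdeal.irrelevant 𝒜).toIdeal

variable (𝒜) in
theorem smul_eq_zero_of_pos [GradedAlgebra 𝒜] {i : ℕ} (hi : i ≠ 0) {a : A} (ha : a ∈ 𝒜 i)
    (m : A ⧸ positiveIdeal 𝒜) : a • m = 0 := by
  obtain ⟨b, rfl⟩ := Submodule.Quotient.mk_surjective _ m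
  have hab : a * b ∈ positiveIdeal 𝒜 := by
    have ha0 : GradedRing.projZeroRingHom 𝒜 a = 0 := by
      rw [GradedRing.projZeroRingHom_apply, DirectSum.decompose_of_mem_ne 𝒜 ha hi]
    rw [positiveIdeal, HomogeneousIdeal.toIdeal_irrelevant, RingHom.mem_ker, map_mul, ha0,
      zero_mul]
  rw [← Submodule.Quotient.mk_smul]
  exact (Submodule.Quotient.mk_eq_zero _).mpr hab

variable (𝒜) in
/-- The degree zero part `A₀` as a graded left `A`-module concentrated in degree `0`, that is,
the quotient `A / J`. -/
def degreeZeroModule [GradedAlgebra 𝒜] : GrModule 𝒜 where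
  carrier := A ⧸ positiveIdeal 𝒜
  deg := concentrated k (A ⧸ positiveIdeal 𝒜)
  isInternal := concentrated_isInternal k _
  smul_mem := by
    intro i j a m ha hm
    by_cases hi : i = 0
    · subst hi
      by_cases hj : j = 0
      · subst hj
        exact Submodule.mem_top (R := k)
      · rw [concentrated, if_neg hj] at hm
        rw [(Submodule.mem_bot k).mp hm, smul_zero]
        exact zero_mem _
    · rw [smul_eq_zero_of_pos 𝒜 hi ha m]
      exact zero_mem _

variable (𝒜) in
/-- A graded algebra `A = ⨁_{i ≥ 0} Aᵢ` is Koszul if it is locally finite, generated in degrees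
`0` and `1` (that is, `Aᵢ · Aⱼ = Aᵢ₊ⱼ`), and the graded module `A₀` is Koszul. -/
structure IsKoszulAlgebra [GradedAlgebra 𝒜] : Prop where
  locallyFinite : ∀ i, Module.Finite k (𝒜 i)
  mul_eq : ∀ i j, 𝒜 i * 𝒜 j = 𝒜 (i + j)
  koszul : (degreeZeroModule 𝒜).IsKoszul

/-- An algebra is self-injective if its (finitely generated) projective left modules are
injective. -/
def IsSelfInjective (R : Type u) [Ring R] : Prop :=
  ∀ (P : Type u) [AddCommGroup P] [Module R P], Module.Finite R P → Module.Projective R P →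
    Module.Injective R P

end GradedAlgebra

section Categories

/-- A (non-negatively) graded `k`-linear category: every morphism space is
`C(x, y) = ⨁ₙ C(x, y)ₙ`, identities have degree `0`, and degrees add under composition. -/
class GradedCategory (k : Type w) [Field k] (C : Type u) [Category.{u} C] [Preadditive C]
    [Linear k C] where
  deg : ∀ x y : C, ℕ → Submodule k (x ⟶ y)
  isInternal : ∀ x y : C, DirectSum.IsInternal (deg x y)
  id_mem : ∀ x : C, 𝟙 x ∈ deg x x 0
  comp_mem : ∀ {x y z : C} {m n : ℕ} {f : x ⟶ y} {g : y ⟶ z},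
    f ∈ deg x y m → g ∈ deg y z n → f ≫ g ∈ deg x z (m + n)

/-- The underlying space of the associated algebra `⨁_{x, y} C(x, y)` of a category with finitely
many objects; an element `a` has the components `a x y : x ⟶ y`. -/
def CatAlgebra (C : Type u) [Category.{u} C] : Type u := ∀ x y : C, (x ⟶ y)

namespace CatAlgebra

@[ext]
theorem ext {C : Type u} [Category.{u} C] {a b : CatAlgebra C} (h : ∀ x y, a x y = b x y) :
    a = b :=
  funext fun x => funext fun y => h x y

variable {k : Type w} [Field k] {C : Type u} [Category.{u} C] [Preadditive C]

instance : AddCommGroup (CatAlgebra C) :=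
  inferInstanceAs (AddCommGroup (∀ x y : C, (x ⟶ y)))

instance [Linear k C] : Module k (CatAlgebra C) :=
  inferInstanceAs (Module k (∀ x y : C, (x ⟶ y)))

@[simp] theorem add_apply (a b : CatAlgebra C) (x y : C) : (a + b) x y = a x y + b x y := rfl
@[simp] theorem zero_apply (x y : C) : (0 : CatAlgebra C) x y = 0 := rfl
@[simp] theorem smul_apply [Linear k C] (c : k) (a : CatAlgebra C) (x y : C) :
    (c • a) x y = c • a x y := rfl

open Classical in
instance : One (CatAlgebra C) where
  one := fun x y => if h : x = y then eqToHom h else 0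

open Classical in
theorem one_apply (x y : C) :
    (1 : CatAlgebra C) x y = if h : x = y then eqToHom h else 0 := rfl

variable [Fintype C]

/-- The product of `β : y ⟶ z` and `α : x ⟶ y` is the composite `βα = α ≫ β`; products of
non-composable morphisms are zero. -/
instance : Mul (CatAlgebra C) where
  mul b a := fun x z => ∑ y, a x y ≫ b y z

theorem mul_apply (b a : CatAlgebra C) (x z : C) : (b * a) x z = ∑ y, a x y ≫ b y z := rfl

instance : Ring (CatAlgebra C) :=
  { (inferInstance : AddCommGroup (CatAlgebra C)), (inferInstance : One (CatAlgebra C)),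
    (inferInstance : Mul (CatAlgebra C)) with
    left_distrib := fun a b c => by
      ext x z; simp [mul_apply, Finset.sum_add_distrib]
    right_distrib := fun a b c => by
      ext x z; simp [mul_apply, Finset.sum_add_distrib]
    zero_mul := fun a => by ext x z; simp [mul_apply]
    mul_zero := fun a => by ext x z; simp [mul_apply]
    mul_assoc := fun a b c => by
      ext x z
      simp only [mul_apply, Preadditive.sum_comp, Preadditive.comp_sum, Category.assoc]
      exact Finset.sum_comm
    one_mul := fun a => by
      ext x z
      rw [mul_apply, Finset.sum_eq_single z]
      · simp [one_apply]
      · intro y _ hy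
        simp [one_apply, hy]
      · simp
    mul_one := fun a => by
      ext x z
      rw [mul_apply, Finset.sum_eq_single x]
      · simp [one_apply]
      · intro y _ hy
        simp [one_apply, Ne.symm hy]
      · simp }

instance [Linear k C] : Algebra k (CatAlgebra C) :=
  Algebra.ofModule
    (fun c a b => by ext x z; simp [mul_apply, Finset.smul_sum])
    (fun c a b => by ext x z; simp [mul_apply, Finset.smul_sum])

variable (k C) in
/-- The grading of the associated algebra of a graded category: `Aₙ = ⨁_{x, y} C(x, y)ₙ`. -/
def grading [Linear k C] [GradedCategory k C] (n : ℕ) : Submodule k (CatAlgebra C) where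
  carrier := {a | ∀ x y, a x y ∈ GradedCategory.deg x y n}
  add_mem' ha hb x y := add_mem (ha x y) (hb x y)
  zero_mem' _ _ := zero_mem _
  smul_mem' c _ ha x y := Submodule.smul_mem _ c (ha x y)

theorem mem_grading [Linear k C] [GradedCategory k C] {n : ℕ} {a : CatAlgebra C} :
    a ∈ grading k C n ↔ ∀ x y, a x y ∈ GradedCategory.deg (k := k) x y n := Iff.rfl

variable (k C) in
theorem grading_isInternal [Linear k C] [GradedCategory k C] :
    DirectSum.IsInternal (grading k C) := by
  classical
  constructor
  · rw [injective_iff_map_eq_zero]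
    intro v hv
    ext n : 1
    apply Subtype.ext
    ext x y
    let φ : (DirectSum ℕ fun n => grading k C n) →+
        DirectSum ℕ fun n => GradedCategory.deg (k := k) x y n :=
      DirectSum.map fun n => (⟨⟨fun a => ⟨a.1 x y, a.2 x y⟩, rfl⟩, fun _ _ => rfl⟩ :
        grading k C n →+ GradedCategory.deg (k := k) x y n)
    have key : ∀ w, DirectSum.coeAddMonoidHom (GradedCategory.deg (k := k) x y) (φ w) =
        (DirectSum.coeAddMonoidHom (grading k C) w) x y := by
      intro w
      induction w using DirectSum.induction_on with
      | zero => simp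
      | of i a =>
        simp only [φ, DirectSum.map_of, DirectSum.coeAddMonoidHom_of]
        rfl
      | add a b ha hb => simp only [map_add, ha, hb, add_apply]
    have h0 : φ v = 0 := by
      apply (GradedCategory.isInternal x y).injective
      rw [key, hv]
      simp
    have := congrArg (fun w => ((w n : GradedCategory.deg (k := k) x y n) : x ⟶ y)) h0
    exact this
  · have htop : (⨆ n, grading k C n) = ⊤ := by
      rw [eq_top_iff]
      intro a _
      let ι : ∀ x y : C, (x ⟶ y) →ₗ[k] CatAlgebra C := fun x y =>
        (LinearMap.single k (fun x : C => ∀ y : C, (x ⟶ y)) x).comp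
          (LinearMap.single k (fun y : C => (x ⟶ y)) y)
      have ha : a = ∑ x, ∑ y, ι x y (a x y) := by
        have h1 : ∀ x, ∑ y, ι x y (a x y) =
            LinearMap.single k (fun x : C => ∀ y : C, (x ⟶ y)) x (a x) := by
          intro x
          simp only [ι]
          refine (map_sum (LinearMap.single k (fun x : C => ∀ y : C, (x ⟶ y)) x) _ _).symm.trans ?_
          congr 1
          exact Finset.univ_sum_single (a x)
        simp only [h1]
        exact (Finset.univ_sum_single (M := fun x : C => ∀ y : C, (x ⟶ y)) a).symm
      rw [ha]
      refine Submodule.sum_mem _ fun x _ => Submodule.sum_mem _ fun y _ => ?_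
      have hle : (⨆ n, GradedCategory.deg (k := k) x y n) ≤
          (⨆ n, grading k C n).comap (ι x y) := by
        refine iSup_le fun n f hf => ?_
        refine Submodule.mem_iSup_of_mem n ?_
        intro x' y'
        change (Pi.single (M := fun x : C => ∀ y : C, (x ⟶ y)) x (Pi.single y f)) x' y' ∈ _
        by_cases hx : x = x'
        · subst hx
          rw [Pi.single_eq_same]
          by_cases hy : y = y'
          · subst hy
            rwa [Pi.single_eq_same]
          · rw [Pi.single_eq_of_ne' hy]
            exact zero_mem _
        · rw [Pi.single_eq_of_ne' hx]
          exact zero_mem _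
      rw [(GradedCategory.isInternal x y).submodule_iSup_eq_top] at hle
      exact hle Submodule.mem_top
    intro a
    have : a ∈ ⨆ n, grading k C n := htop ▸ Submodule.mem_top
    rw [Submodule.mem_iSup_iff_exists_dfinsupp] at this
    obtain ⟨v, hv⟩ := this
    refine ⟨v, ?_⟩
    rw [← hv]
    rfl

instance [Linear k C] [GradedCategory k C] : GradedAlgebra (grading k C) where
  one_mem x y := by
    classical
    rw [one_apply]
    split_ifs with h
    · subst h
      exact GradedCategory.id_mem x
    · exact zero_mem _
  mul_mem i j a b ha hb x z := by
    rw [mul_apply, add_comm]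
    exact Submodule.sum_mem _ fun y _ => GradedCategory.comp_mem (hb x y) (ha y z)
  toDecomposition := (grading_isInternal k C).chooseDecomposition

end CatAlgebra

/-- `C` is directed with respect to the given partial order on its set of objects: the category is
skeletal and locally finite (its morphism spaces are finite-dimensional), and `C(x, y) ≠ 0` only
if `x ≤ y`. -/
class IsDirectedCategory (k : Type w) [Field k] (C : Type u) [Category.{u} C] [Preadditive C]
    [Linear k C] [PartialOrder C] : Prop where
  skeletal : Skeletal C
  finite : ∀ x y : C, Module.Finite k (x ⟶ y)
  le_of_hom_ne_zero : ∀ {x y : C} (f : x ⟶ y), f ≠ 0 → x ≤ y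

/-- A graded directed category: a directed category with a grading such that the degree zero part
consists precisely of the endomorphisms, `C₀ = ⨁ₓ C(x, x)`. -/
class IsGradedDirectedCategory (k : Type w) [Field k] (C : Type u) [Category.{u} C]
    [Preadditive C] [Linear k C] [GradedCategory k C] [PartialOrder C] : Prop
    extends IsDirectedCategory k C where
  deg_zero_end : ∀ x : C, GradedCategory.deg (k := k) x x 0 = ⊤
  deg_zero_ne : ∀ x y : C, x ≠ y → GradedCategory.deg (k := k) x y 0 = ⊥

/-- A graded category with finitely many objects is Koszul if its associated graded algebra is. -/
def IsKoszulCategory (k : Type w) [Field k] (C : Type u) [Fintype C] [Category.{u} C]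
    [Preadditive C] [Linear k C] [GradedCategory k C] : Prop :=
  IsKoszulAlgebra (CatAlgebra.grading k C)

theorem range_lof_isInternal (k : Type w) [Field k] (M : ℕ → Type u) [∀ n, AddCommGroup (M n)]
    [∀ n, Module k (M n)] :
    DirectSum.IsInternal fun n => LinearMap.range (DirectSum.lof k ℕ M n) := by
  classical
  constructor
  · rw [injective_iff_map_eq_zero]
    intro v hv
    have key : ∀ (n : ℕ) (w : DirectSum ℕ fun n => LinearMap.range (DirectSum.lof k ℕ M n)),
        DirectSum.lof k ℕ M n (DirectSum.coeAddMonoidHom _ w n) = w n := by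
      intro n w
      induction w using DirectSum.induction_on with
      | zero => simp
      | add a b ha hb => simp only [map_add, DirectSum.add_apply, ha, hb, Submodule.coe_add]
      | of i a =>
        obtain ⟨_, f, rfl⟩ := a
        rw [DirectSum.coeAddMonoidHom_of]
        by_cases h : i = n
        · subst h
          simp [DirectSum.lof_eq_of]
        · simp only [DirectSum.lof_eq_of]
          rw [DirectSum.of_eq_of_ne _ _ _ (Ne.symm h), DirectSum.of_eq_of_ne _ _ _ (Ne.symm h)]
          simp
    ext n : 1
    apply Subtype.ext
    rw [← key, hv]
    simp
  · intro a
    induction a using DirectSum.induction_on with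
    | zero => exact ⟨0, map_zero _⟩
    | of n f =>
      exact ⟨DirectSum.of (fun n => LinearMap.range (DirectSum.lof k ℕ M n)) n ⟨_, f, rfl⟩,
        DirectSum.coeAddMonoidHom_of _ _ _⟩
    | add a b ha hb =>
      obtain ⟨v, rfl⟩ := ha
      obtain ⟨w, rfl⟩ := hb
      exact ⟨v + w, map_add _ _ _⟩

section Yoneda

variable (k : Type w) [Field k] (C : Type u) [Fintype C] [PartialOrder C] [Category.{u} C]
  [Preadditive C] [Linear k C] [IsDirectedCategory k C]

/-- For a directed category, taking the component at `x` is a ring homomorphism from the associated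
algebra to the endomorphism ring `C(x, x)`. -/
def evalEnd (x : C) : CatAlgebra C →+* End x where
  toFun a := a x x
  map_one' := by simp [CatAlgebra.one_apply]
  map_zero' := rfl
  map_add' _ _ := rfl
  map_mul' a b := by
    rw [CatAlgebra.mul_apply, Finset.sum_eq_single x]
    · rfl
    · intro y _ hy
      by_contra h
      have h1 : b x y ≠ 0 := fun h0 => h (by simp [h0])
      have h2 : a y x ≠ 0 := fun h0 => h (by simp [h0])
      exact hy (le_antisymm (IsDirectedCategory.le_of_hom_ne_zero (k := k) _ h2)
        (IsDirectedCategory.le_of_hom_ne_zero (k := k) _ h1))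
    · simp

/-- The `C`-module `C(x, x)`, supported on the object `x`: as a module over the associated algebra,
`a` acts by postcomposition with `a x x`. -/
def endModule (x : C) : ModuleCat.{u} (CatAlgebra C) :=
  (ModuleCat.restrictScalars (evalEnd k C x)).obj (ModuleCat.of (End x) (End x))

/-- The space of morphisms `x ⟶ y` in the Yoneda category,
`⨁ₙ Extⁿ(C(x, x), C(y, y))`, the extensions being those of `C`-modules. -/
abbrev YonedaHom (x y : C) : Type u :=
  DirectSum ℕ fun n => Abelian.Ext.{u} (endModule k C x) (endModule k C y) n

/-- The Yoneda product. -/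
def yonedaComp (x y z : C) : YonedaHom k C x y →ₗ[k] YonedaHom k C y z →ₗ[k] YonedaHom k C x z :=
  DirectSum.toModule k ℕ _ fun m => LinearMap.flip <|
    DirectSum.toModule k ℕ _ fun n => LinearMap.flip <|
      (Abelian.Ext.bilinearCompOfLinear k (endModule k C x) (endModule k C y) (endModule k C z)
        m n (m + n) rfl).compr₂
        (DirectSum.lof k ℕ (fun i => Abelian.Ext.{u} (endModule k C x) (endModule k C z) i) (m + n))

theorem yonedaComp_lof {x y z : C} {m n p : ℕ} (h : m + n = p)
    (f : Abelian.Ext.{u} (endModule k C x) (endModule k C y) m)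
    (g : Abelian.Ext.{u} (endModule k C y) (endModule k C z) n) :
    yonedaComp k C x y z (DirectSum.lof k ℕ _ m f) (DirectSum.lof k ℕ _ n g) =
      DirectSum.lof k ℕ _ p (f.comp g h) := by
  subst h
  simp [yonedaComp]

theorem yonedaHom_induction {x y : C} {p : YonedaHom k C x y → Prop} (f : YonedaHom k C x y)
    (zero : p 0)
    (lof : ∀ n (f : Abelian.Ext.{u} (endModule k C x) (endModule k C y) n),
      p (DirectSum.lof k ℕ _ n f))
    (add : ∀ f g, p f → p g → p (f + g)) : p f :=
  DirectSum.induction_on f zero lof add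

/-- The identity of `C(x, x)`, as an element of `Ext⁰(C(x, x), C(x, x))`. -/
def yonedaId (x : C) : YonedaHom k C x x :=
  DirectSum.lof k ℕ (fun i => Abelian.Ext.{u} (endModule k C x) (endModule k C x) i) 0
    (Abelian.Ext.mk₀ (𝟙 (endModule k C x)))

theorem yonedaId_comp {x y : C} (f : YonedaHom k C x y) :
    yonedaComp k C x x y (yonedaId k C x) f = f := by
  induction f using yonedaHom_induction with
  | zero => exact map_zero _
  | lof n f => rw [yonedaId, yonedaComp_lof k C (zero_add n), Abelian.Ext.mk₀_id_comp]
  | add f g hf hg => rw [map_add, hf, hg]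

theorem yonedaComp_id {x y : C} (f : YonedaHom k C x y) :
    yonedaComp k C x y y f (yonedaId k C y) = f := by
  induction f using yonedaHom_induction with
  | zero => exact LinearMap.map_zero₂ _ _
  | lof n f => rw [yonedaId, yonedaComp_lof k C (add_zero n), Abelian.Ext.comp_mk₀_id]
  | add f g hf hg => rw [LinearMap.map_add₂, hf, hg]

theorem yonedaComp_assoc {x y z t : C} (f : YonedaHom k C x y) (g : YonedaHom k C y z)
    (h : YonedaHom k C z t) :
    yonedaComp k C x z t (yonedaComp k C x y z f g) h =
      yonedaComp k C x y t f (yonedaComp k C y z t g h) := by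
  induction f using yonedaHom_induction with
  | zero => simp only [LinearMap.map_zero₂]
  | add f f' hf hf' => simp only [LinearMap.map_add₂, hf, hf']
  | lof l f =>
    induction g using yonedaHom_induction with
    | zero => simp only [LinearMap.zero_apply, map_zero]
    | add g g' hg hg' => simp only [LinearMap.add_apply, map_add, hg, hg']
    | lof m g =>
      induction h using yonedaHom_induction with
      | zero => simp only [map_zero]
      | add h h' hh hh' => simp only [map_add, hh, hh']
      | lof n h =>
        rw [yonedaComp_lof k C rfl, yonedaComp_lof k C rfl, yonedaComp_lof k C rfl,
          yonedaComp_lof k C (add_assoc l m n).symm, Abelian.Ext.comp_assoc f g h rfl rfl rfl]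

/-- The Yoneda category `E(C₀) = Ext*(C₀, C₀)`; its objects are those of `C`. -/
def YonedaCategory (k : Type w) [Field k] (C : Type u) [Fintype C] [PartialOrder C]
    [Category.{u} C] [Preadditive C] [Linear k C] [IsDirectedCategory k C] : Type u := C

namespace YonedaCategory

instance : Fintype (YonedaCategory k C) := inferInstanceAs (Fintype C)

/-- The objects of the Yoneda category carry the same partial order as those of `C`. -/
instance : PartialOrder (YonedaCategory k C) := inferInstanceAs (PartialOrder C)

instance : Category.{u} (YonedaCategory k C) where
  Hom x y := YonedaHom k C x y
  id x := yonedaId k C x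
  comp {x y z} f g := yonedaComp k C x y z f g
  id_comp f := yonedaId_comp k C f
  comp_id f := yonedaComp_id k C f
  assoc f g h := yonedaComp_assoc k C f g h

instance : Preadditive (YonedaCategory k C) where
  homGroup x y := inferInstanceAs (AddCommGroup (YonedaHom k C x y))
  add_comp x y z f f' g := LinearMap.map_add₂ (yonedaComp k C x y z) f f' g
  comp_add x y z f g g' := (yonedaComp k C x y z f).map_add g g'

instance : Linear k (YonedaCategory k C) where
  homModule x y := inferInstanceAs (Module k (YonedaHom k C x y))
  smul_comp x y z c f g := LinearMap.map_smul₂ (yonedaComp k C x y z) c f g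
  comp_smul x y z f c g := (yonedaComp k C x y z f).map_smul c g

/-- The grading of the Yoneda category: `E(x, y)ₙ = Extⁿ(C(x, x), C(y, y))`. -/
instance : GradedCategory k (YonedaCategory k C) where
  deg x y n := LinearMap.range
    (DirectSum.lof k ℕ (fun i => Abelian.Ext.{u} (endModule k C x) (endModule k C y) i) n)
  isInternal x y := range_lof_isInternal k _
  id_mem x := ⟨_, rfl⟩
  comp_mem {x y z m n} := by
    rintro _ _ ⟨f, rfl⟩ ⟨g, rfl⟩
    exact ⟨f.comp g rfl, (yonedaComp_lof k C rfl f g).symm⟩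

end YonedaCategory

end Yoneda

end Categories

end DirectedKoszul

end

/-! Write `A` for the algebra of the category, `J` for its ideal of positive degree, `A₀ = A / J`,
and `E` for the Yoneda algebra. The linear resolution of `E₀` comes from the `J`-adic filtration of
`A` itself. The extension `Jⁱ / Jⁱ⁺²` has a class in `Ext¹(Jⁱ / Jⁱ⁺¹, Jⁱ⁺¹ / Jⁱ⁺²)`, and Yoneda
multiplication by these classes gives a complex of `E`-modules `⋯ → Ext*(J / J², A₀) → Ext*(A / J,
A₀) ≅ E → E₀`.

Two facts make it a linear projective resolution. Each `Jⁱ / Jⁱ⁺¹` is a summand of a finite power of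
`A₀` (`LinearResolution.inAdd_gr`), so its `Ext` module is a summand of a power of `E`, generated by
its `Ext⁰` part. And for `N` killed by `J` the restriction `Extⁿ(Jⁱ, N) → Extⁿ(Jⁱ⁺¹, N)` is zero
(`LinearResolution.pull_filt_eq_zero`), so the long exact sequences break into short ones, which
splice to exactness (`HasLinearGr.exact_augmentation`, `HasLinearGr.exact_differential`).

Both facts are proved for the images `B` of the differentials in a linear resolution of `A₀`.
Strictness gives short exact sequences relating graded pieces of consecutive images to those of the
projective between them. Self-injectivity enters only as injectivity of `A₀` relative to modules
killed by `J`, which splits these sequences. Since `J A₀ = 0`, the filtration of the image in the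
first projective is its own `J`-adic filtration from the first step on; this projective has `A` as a
summand, so the inductions feed themselves.

Directedness of `E` comes from idempotents of upper sets: they kill `Ext*(C(x, x), C(y, y))` unless
`x ≤ y`, and kill higher self-extensions. The start of the resolution gives `Eₙ₊₁ = Eₙ E₁`
(`HasLinearGr.grading_succ_le`). A nonzero class of degree `n` therefore climbs `n` strict steps in
a finite poset, which bounds the degrees and makes the morphism spaces of `E` finite-dimensional. -/

noncomputable section

namespace DirectedKoszul

/-! ### Contravariant functoriality of `Ext` and its long exact sequence, for linear maps. -/

section ExtPullback

open Abelian

variable {A : Type u} [Ring A] {X Y Z : Type u} [AddCommGroup X] [Module A X]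
  [AddCommGroup Y] [Module A Y] [AddCommGroup Z] [Module A Z] {N : ModuleCat.{u} A} {n : ℕ}

/-- The map `Extⁿ(Y, N) → Extⁿ(X, N)` induced by a linear map `X → Y`. -/
def pull (f : X →ₗ[A] Y) (e : Ext.{u} (ModuleCat.of A Y) N n) : Ext.{u} (ModuleCat.of A X) N n :=
  (Ext.mk₀ (ModuleCat.ofHom f)).comp e (zero_add n)

@[simp] theorem pull_zero_right (f : X →ₗ[A] Y) : pull f (0 : Ext.{u} (ModuleCat.of A Y) N n) = 0 :=
  Ext.comp_zero _ _ _ _ _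

@[simp] theorem pull_zero (e : Ext.{u} (ModuleCat.of A Y) N n) : pull (0 : X →ₗ[A] Y) e = 0 := by
  rw [pull, show ModuleCat.ofHom (0 : X →ₗ[A] Y) = 0 from rfl, Ext.mk₀_zero, Ext.zero_comp]

@[simp] theorem pull_id (e : Ext.{u} (ModuleCat.of A Y) N n) :
    pull (LinearMap.id : Y →ₗ[A] Y) e = e :=
  Ext.mk₀_id_comp _

theorem pull_pull (f : X →ₗ[A] Y) (g : Y →ₗ[A] Z) (e : Ext.{u} (ModuleCat.of A Z) N n) :
    pull f (pull g e) = pull (g ∘ₗ f) e :=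
  Ext.mk₀_comp_mk₀_assoc _ _ _

theorem pull_add (f g : X →ₗ[A] Y) (e : Ext.{u} (ModuleCat.of A Y) N n) :
    pull (f + g) e = pull f e + pull g e := by
  rw [pull, show ModuleCat.ofHom (f + g) = ModuleCat.ofHom f + ModuleCat.ofHom g from rfl,
    Ext.mk₀_add, Ext.add_comp]
  rfl

theorem pull_sum {ι : Type*} (s : Finset ι) (f : ι → X →ₗ[A] Y)
    (e : Ext.{u} (ModuleCat.of A Y) N n) :
    pull (∑ i ∈ s, f i) e = ∑ i ∈ s, pull (f i) e := by
  classical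
  induction s using Finset.induction_on with
  | empty => simp
  | insert i s hi ih => rw [Finset.sum_insert hi, Finset.sum_insert hi, pull_add, ih]

/-- Two linear maps `X → Y → Z` forming a short exact sequence. -/
structure IsSES (f : X →ₗ[A] Y) (g : Y →ₗ[A] Z) : Prop where
  injective : Function.Injective f
  exact : Function.Exact f g
  surjective : Function.Surjective g

namespace IsSES

variable {f : X →ₗ[A] Y} {g : Y →ₗ[A] Z}

theorem shortExact (h : IsSES f g) :
    (ShortComplex.mk (ModuleCat.ofHom f) (ModuleCat.ofHom g)
      (by rw [← ModuleCat.ofHom_comp, h.exact.linearMap_comp_eq_zero]; rfl)).ShortExact :=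
  ModuleCat.shortComplex_shortExact _ h.exact h.injective h.surjective

/-- The class in `Ext¹(Z, X)` of a short exact sequence `X → Y → Z`. -/
def extClass (h : IsSES f g) : Ext.{u} (ModuleCat.of A Z) (ModuleCat.of A X) 1 :=
  h.shortExact.extClass

theorem exists_pull_right (h : IsSES f g) (e : Ext.{u} (ModuleCat.of A Y) N n)
    (he : pull f e = 0) : ∃ e', pull g e' = e :=
  Ext.contravariant_sequence_exact₂ h.shortExact N e he

theorem exists_pull_left (h : IsSES f g) (e : Ext.{u} (ModuleCat.of A X) N n)
    (he : h.extClass.comp e (add_comm 1 n) = 0) : ∃ e', pull f e' = e :=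
  Ext.contravariant_sequence_exact₁ h.shortExact N e _ he

theorem exists_extClass_comp (h : IsSES f g) (e : Ext.{u} (ModuleCat.of A Z) N (n + 1))
    (he : pull g e = 0) : ∃ e', h.extClass.comp e' (add_comm 1 n) = e :=
  Ext.contravariant_sequence_exact₃ h.shortExact N e he _

theorem extClass_comp_pull (h : IsSES f g) (e : Ext.{u} (ModuleCat.of A Y) N n) {m : ℕ}
    (hm : 1 + n = m) : h.extClass.comp (pull f e) hm = 0 :=
  h.shortExact.extClass_comp_assoc e

theorem pull_extClass_comp (h : IsSES f g) (e : Ext.{u} (ModuleCat.of A X) N n) {m : ℕ}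
    (hm : 1 + n = m) : pull g (h.extClass.comp e hm) = 0 :=
  h.shortExact.comp_extClass_assoc e hm

theorem pull_injective_zero (h : IsSES f g) (e : Ext.{u} (ModuleCat.of A Z) N 0)
    (he : pull g e = 0) : e = 0 := by
  have := h.shortExact.epi_g
  exact (injective_iff_map_eq_zero _).mp
    (Ext.precomp_mk₀_injective_of_epi N (ModuleCat.ofHom g)) e he

end IsSES

theorem ext_eq_zero_of_projective [Module.Projective A X]
    (e : Ext.{u} (ModuleCat.of A X) N (n + 1)) : e = 0 := by
  have : Projective (ModuleCat.of A X) := (IsProjective.iff_projective X).mp inferInstance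
  exact Ext.eq_zero_of_projective e

end ExtPullback

/-! ### Summands of finite powers, relative injectivity and the `J`-adic filtration. -/

section Filtration

variable {A : Type u} [Ring A] {X Y Z : Type u} [AddCommGroup X] [Module A X]
  [AddCommGroup Y] [Module A Y] [AddCommGroup Z] [Module A Z]

/-- `X` is a direct summand of a finite power of `Y`. -/
def InAdd (Y X : Type u) [AddCommGroup X] [Module A X] [AddCommGroup Y] [Module A Y] : Prop :=
  ∃ (r : ℕ) (s : Fin r → X →ₗ[A] Y) (p : Fin r → Y →ₗ[A] X), ∑ j, p j ∘ₗ s j = LinearMap.id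

theorem InAdd.of_retract (s : X →ₗ[A] Y) (p : Y →ₗ[A] X) (h : p ∘ₗ s = LinearMap.id) :
    InAdd (A := A) Y X :=
  ⟨1, fun _ => s, fun _ => p, by simpa using h⟩

theorem InAdd.of_bijective (f : X →ₗ[A] Y) (hf : Function.Bijective f) : InAdd (A := A) X Y :=
  .of_retract (LinearEquiv.ofBijective f hf).symm.toLinearMap f <| by
    ext y
    exact (LinearEquiv.ofBijective f hf).apply_symm_apply y

theorem InAdd.trans (h₁ : InAdd (A := A) Z Y) (h₂ : InAdd (A := A) Y X) : InAdd (A := A) Z X := by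
  obtain ⟨r, s, p, h⟩ := h₁
  obtain ⟨r', s', p', h'⟩ := h₂
  refine ⟨r' * r, fun j => s (finProdFinEquiv.symm j).2 ∘ₗ s' (finProdFinEquiv.symm j).1,
    fun j => p' (finProdFinEquiv.symm j).1 ∘ₗ p (finProdFinEquiv.symm j).2, ?_⟩
  rw [finProdFinEquiv.symm.sum_comp (fun q : Fin r' × Fin r =>
    (p' q.1 ∘ₗ p q.2) ∘ₗ (s q.2 ∘ₗ s' q.1)), Fintype.sum_prod_type, ← h']
  refine Finset.sum_congr rfl fun j _ => ?_
  ext x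
  have := congrArg (p' j) (LinearMap.congr_fun h (s' j x))
  simpa using this

theorem InAdd.of_finite_projective [Module.Finite A X] [Module.Projective A X] :
    InAdd (A := A) A X := by
  classical
  obtain ⟨r, f, hf⟩ := Module.Finite.exists_fin' A X
  obtain ⟨s, hs⟩ := Module.projective_lifting_property f LinearMap.id hf
  refine ⟨r, fun j => LinearMap.proj j ∘ₗ s, fun j => f ∘ₗ LinearMap.single A (fun _ => A) j, ?_⟩
  ext x
  have h1 : ∑ j, Pi.single j (s x j) = s x := Finset.univ_sum_single (s x)
  have h2 : f (s x) = x := LinearMap.congr_fun hs x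
  simp only [LinearMap.sum_apply, LinearMap.comp_apply, LinearMap.proj_apply,
    LinearMap.single_apply, ← map_sum, h1, h2, LinearMap.id_apply]

variable (J : Ideal A)

/-- The module `X` is annihilated by `J`. -/
def IsKilled (X : Type u) [AddCommGroup X] [Module A X] : Prop :=
  ∀ a ∈ J, ∀ x : X, a • x = 0

/-- `X` is injective relative to the modules annihilated by `J`. -/
def IsRelInjective (X : Type u) [AddCommGroup X] [Module A X] : Prop :=
  ∀ ⦃Y Z : Type u⦄ [AddCommGroup Y] [Module A Y] [AddCommGroup Z] [Module A Z]
    (f : Y →ₗ[A] Z), Function.Injective f → IsKilled J Z → ∀ g : Y →ₗ[A] X,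
    ∃ h : Z →ₗ[A] X, h ∘ₗ f = g

variable {J}

theorem IsRelInjective.of_inAdd (hY : IsRelInjective J Y) (h : InAdd (A := A) Y X) :
    IsRelInjective J X := by
  obtain ⟨r, s, p, hsp⟩ := h
  intro U V _ _ _ _ f hf hV g
  choose t ht using fun j => hY f hf hV (s j ∘ₗ g)
  refine ⟨∑ j, p j ∘ₗ t j, ?_⟩
  ext u
  have h1 : ∀ j, t j (f u) = s j (g u) := fun j => LinearMap.congr_fun (ht j) u
  have h2 := LinearMap.congr_fun hsp (g u)
  simpa [h1] using h2

/-- The filtration `X ⊇ J X ⊇ J² X ⊇ ⋯`. -/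
def filt (J : Ideal A) (X : Type u) [AddCommGroup X] [Module A X] : ℕ → Submodule A X
  | 0 => ⊤
  | i + 1 => J • filt J X i

theorem filt_succ_le (J : Ideal A) (i : ℕ) : filt J X (i + 1) ≤ filt J X i :=
  Submodule.smul_le_right

theorem map_filt_le (J : Ideal A) (f : X →ₗ[A] Y) (i : ℕ) : (filt J X i).map f ≤ filt J Y i := by
  induction i with
  | zero => exact le_top
  | succ i ih =>
    rw [filt, Submodule.map_smul'']
    exact Submodule.smul_mono le_rfl ih

/-- The map of the `i`-th steps of the filtrations induced by a linear map. -/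
def filtMap (J : Ideal A) (f : X →ₗ[A] Y) (i : ℕ) : filt J X i →ₗ[A] filt J Y i :=
  f.restrict fun _ hx => map_filt_le J f i (Submodule.mem_map_of_mem hx)

@[simp] theorem coe_filtMap (J : Ideal A) (f : X →ₗ[A] Y) (i : ℕ) (x : filt J X i) :
    (filtMap J f i x : Y) = f x := rfl

/-- The subquotient `L / L'` for submodules `L' ⊆ L`. -/
abbrev SubQuot (L L' : Submodule A X) : Type u := L ⧸ L'.submoduleOf L

theorem mem_submoduleOf {L L' : Submodule A X} {x : L} :
    x ∈ L'.submoduleOf L ↔ (x : X) ∈ L' := Iff.rfl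

theorem SubQuot.isSES {L L' : Submodule A X} (h : L' ≤ L) :
    IsSES (Submodule.inclusion h) (L'.submoduleOf L).mkQ where
  injective := Submodule.inclusion_injective h
  surjective := Submodule.mkQ_surjective _
  exact x := by
    rw [← LinearMap.mem_ker, Submodule.ker_mkQ, mem_submoduleOf]
    exact ⟨fun hx => ⟨⟨x, hx⟩, rfl⟩, by rintro ⟨y, rfl⟩; exact y.2⟩

theorem SubQuot.isKilled {L L' : Submodule A X} (h : J • L ≤ L') : IsKilled J (SubQuot L L') := by
  intro a ha x
  obtain ⟨x, rfl⟩ := Submodule.mkQ_surjective _ x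
  rw [← map_smul]
  exact (Submodule.Quotient.mk_eq_zero _).mpr (h (Submodule.smul_mem_smul ha x.2))

theorem mapQ_injective {p : Submodule A X} {q : Submodule A Y} {f : X →ₗ[A] Y} (h : p ≤ q.comap f)
    (h' : q.comap f ≤ p) : Function.Injective (p.mapQ q f h) := by
  rw [← LinearMap.ker_eq_bot, Submodule.ker_mapQ, eq_bot_iff, Submodule.map_le_iff_le_comap,
    ← LinearMap.ker, Submodule.ker_mkQ]
  exact h'

theorem mapQ_surjective {p : Submodule A X} {q : Submodule A Y} {f : X →ₗ[A] Y} (h : p ≤ q.comap f)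
    (hf : Function.Surjective f) : Function.Surjective (p.mapQ q f h) := by
  intro y
  obtain ⟨y, rfl⟩ := Submodule.mkQ_surjective _ y
  obtain ⟨x, rfl⟩ := hf y
  exact ⟨Submodule.Quotient.mk x, rfl⟩

/-- The subquotient `Jⁱ X / Jⁱ⁺¹ X`. -/
abbrev Gr (J : Ideal A) (X : Type u) [AddCommGroup X] [Module A X] (i : ℕ) : Type u :=
  SubQuot (filt J X i) (filt J X (i + 1))

/-- The map `Jⁱ X / Jⁱ⁺¹ X → Jⁱ Y / Jⁱ⁺¹ Y` induced by a linear map. -/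
def grMap (J : Ideal A) (f : X →ₗ[A] Y) (i : ℕ) : Gr J X i →ₗ[A] Gr J Y i :=
  Submodule.mapQ _ _ (filtMap J f i) fun x hx => by
    rw [Submodule.mem_comap, mem_submoduleOf]
    exact map_filt_le J f _ (Submodule.mem_map_of_mem hx)

theorem InAdd.gr (h : InAdd (A := A) Y X) (i : ℕ) : InAdd (A := A) (Gr J Y i) (Gr J X i) := by
  obtain ⟨r, s, p, h⟩ := h
  refine ⟨r, fun j => grMap J (s j) i, fun j => grMap J (p j) i, ?_⟩
  apply Submodule.linearMap_qext
  ext x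
  have h1 : ∑ j, filtMap J (p j) i (filtMap J (s j) i x) = x := by
    apply Subtype.ext
    have := LinearMap.congr_fun h (x : X)
    simpa using this
  have h2 : ∀ j, grMap J (p j) i (grMap J (s j) i (Submodule.Quotient.mk x)) =
      Submodule.mkQ _ (filtMap J (p j) i (filtMap J (s j) i x)) := fun j => rfl
  simp only [LinearMap.comp_apply, LinearMap.sum_apply, Submodule.mkQ_apply, h2]
  simp only [← Submodule.mkQ_apply, ← map_sum, h1, LinearMap.id_apply]

/-- By functoriality of the filtration, the inclusion for `X` is a sum of maps that factor through
the inclusion for `Y`. -/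
theorem pull_filt_eq_zero_of_inAdd {N : ModuleCat.{u} A} {n i : ℕ} (h : InAdd (A := A) Y X)
    (hY : ∀ e : Abelian.Ext.{u} (ModuleCat.of A (filt J Y i)) N n,
      pull (Submodule.inclusion (filt_succ_le J i)) e = 0)
    (e : Abelian.Ext.{u} (ModuleCat.of A (filt J X i)) N n) :
    pull (Submodule.inclusion (filt_succ_le J i)) e = 0 := by
  obtain ⟨r, s, p, h⟩ := h
  have h1 : Submodule.inclusion (filt_succ_le J (X := X) i) = ∑ j, filtMap J (p j) i ∘ₗ
      Submodule.inclusion (filt_succ_le J i) ∘ₗ filtMap J (s j) (i + 1) := by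
    ext x
    have := LinearMap.congr_fun h (x : X)
    simpa using this.symm
  rw [h1, pull_sum]
  refine Finset.sum_eq_zero fun j _ => ?_
  rw [← pull_pull, ← pull_pull, hY, pull_zero_right]

theorem ext_filt_zero_eq_zero {N : ModuleCat.{u} A} {n : ℕ} (h : InAdd (A := A) A X)
    (e : Abelian.Ext.{u} (ModuleCat.of A (filt J X 0)) N (n + 1)) : e = 0 := by
  obtain ⟨r, s, p, h⟩ := h
  -- `filt J X 0` is the submodule `⊤` rather than `X` itself, so the factorization of the identity
  -- through `A` has to restrict domain and codomain.
  have h1 : (LinearMap.id : filt J X 0 →ₗ[A] _) = ∑ j,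
      LinearMap.codRestrict (filt J X 0) (p j) (fun _ => trivial) ∘ₗ s j ∘ₗ Submodule.subtype _ := by
    ext x
    have := LinearMap.congr_fun h (x : X)
    simp only [LinearMap.sum_apply, LinearMap.comp_apply] at this
    rw [LinearMap.sum_apply, AddSubmonoidClass.coe_finsetSum]
    exact this.symm
  rw [← pull_id e, h1, pull_sum]
  refine Finset.sum_eq_zero fun j _ => ?_
  rw [← pull_pull, ext_eq_zero_of_projective (pull _ e), pull_zero_right]

end Filtration

/-! ### Filtered images of the differentials in a linear resolution. -/

section LinearResolution

variable {A : Type u} [Ring A]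

/-- A sequence of modules `⋯ → Q₂ → Q₁ → Q₀`, exact at `Qᵢ` for `i ≥ 1`, with `J Q₀ = 0` and
finitely generated projective terms from `Q₁` on, which is linear: the differentials have image in
the radical `J Q`, and are strict for the `J`-adic filtrations after a shift by one. Moreover `A`
itself is a direct summand of a power of `Q₁`. -/
structure LinearResolution (J : Ideal A) where
  Q : ℕ → Type u
  [addCommGroup : ∀ m, AddCommGroup (Q m)]
  [module : ∀ m, Module A (Q m)]
  D : ∀ m, Q (m + 1) →ₗ[A] Q m
  exact : ∀ m, Function.Exact (D (m + 1)) (D m)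
  isKilled : IsKilled J (Q 0)
  inAdd : ∀ m, InAdd (A := A) A (Q (m + 1))
  inAdd_one : InAdd (A := A) (Q 1) A
  mem_filt_one : ∀ m q, D (m + 1) q ∈ filt J (Q (m + 1)) 1
  strict : ∀ m i q, D (m + 1) q ∈ filt J (Q (m + 1)) (i + 1) →
    ∃ q' ∈ filt J (Q (m + 2)) i, D (m + 1) q' = D (m + 1) q

namespace LinearResolution

attribute [instance] LinearResolution.addCommGroup LinearResolution.module

variable {J : Ideal A} (R : LinearResolution J)

/-- The filtration of the image of the differential. -/
def B (m i : ℕ) : Submodule A (R.Q m) := (filt J (R.Q (m + 1)) i).map (R.D m)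

theorem B_succ (m i : ℕ) : R.B m (i + 1) = J • R.B m i := by
  rw [B, filt, Submodule.map_smul'']
  rfl

theorem B_succ_le (m i : ℕ) : R.B m (i + 1) ≤ R.B m i :=
  Submodule.map_mono (filt_succ_le J i)

theorem B_zero_succ (i : ℕ) : R.B 0 (i + 1) = ⊥ := by
  rw [B_succ, eq_bot_iff, Submodule.smul_le]
  intro a ha x _
  exact R.isKilled a ha x

theorem B_le_filt (m i : ℕ) : R.B (m + 1) i ≤ filt J (R.Q (m + 1)) (i + 1) := by
  induction i with
  | zero =>
    rintro _ ⟨q, -, rfl⟩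
    exact R.mem_filt_one m q
  | succ i ih =>
    rw [B_succ, filt]
    exact Submodule.smul_mono le_rfl ih

/-- This is the use of strictness: a cycle in `Jⁱ⁺¹ Q` bounds an element of `Jⁱ Q`. With `B_le_filt`
it says that the filtration of the image is induced from that of `Q`, shifted by one. -/
theorem mem_B_of_mem_filt {m i : ℕ} {x : R.Q (m + 1)} (h0 : R.D m x = 0)
    (hx : x ∈ filt J (R.Q (m + 1)) (i + 1)) : x ∈ R.B (m + 1) i := by
  obtain ⟨q, rfl⟩ := (R.exact m x).mp h0
  obtain ⟨q', hq', h⟩ := R.strict m i q hx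
  exact ⟨q', hq', h⟩

theorem B_pred_le_filt (m : ℕ) : ∀ i, R.B (m + 1) (i - 1) ≤ filt J (R.Q (m + 1)) i
  | 0 => le_top
  | i + 1 => R.B_le_filt m i

/-- The differential as a map onto the `i`-th step of the filtration of its image. -/
def toB (m i : ℕ) : filt J (R.Q (m + 1)) i →ₗ[A] R.B m i :=
  (R.D m).restrict fun _ hx => Submodule.mem_map_of_mem hx

@[simp] theorem coe_toB (m i : ℕ) (x : filt J (R.Q (m + 1)) i) : (R.toB m i x : R.Q m) = R.D m x :=
  rfl

theorem toB_surjective (m i : ℕ) : Function.Surjective (R.toB m i) := by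
  rintro ⟨_, x, hx, rfl⟩
  exact ⟨⟨x, hx⟩, rfl⟩

/-- The truncated subtraction is intended: for `i = 0` the kernel of the differential is the whole
image `B (m + 1) 0`, and for `i ≥ 1` its intersection with `Jⁱ Q` is `B (m + 1) (i - 1)` by
strictness. -/
theorem isSES (m i : ℕ) : IsSES (Submodule.inclusion (R.B_pred_le_filt m i)) (R.toB m i) where
  injective := Submodule.inclusion_injective _
  surjective := R.toB_surjective m i
  exact := by
    rintro ⟨x, hx⟩
    constructor
    · intro h
      have h0 : R.D m x = 0 := congrArg Subtype.val h
      suffices hB : x ∈ R.B (m + 1) (i - 1) from ⟨⟨x, hB⟩, rfl⟩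
      cases i with
      | zero =>
        obtain ⟨q, rfl⟩ := (R.exact m x).mp h0
        exact ⟨q, trivial, rfl⟩
      | succ i => exact R.mem_B_of_mem_filt h0 hx
    · rintro ⟨y, h⟩
      obtain ⟨q, -, hq⟩ := y.2
      have hyx : (y : R.Q (m + 1)) = x := congrArg Subtype.val h
      apply Subtype.ext
      change R.D m x = 0
      rw [← hyx, ← hq]
      exact (R.exact m).apply_apply_eq_zero q

/-- As `J` kills `Q 0`, every element of `J Q₁` is a cycle. This turns statements about images into
statements about the filtration of `Q₁`, and hence of `A`, which is what closes the inductions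
below. -/
theorem B_one (i : ℕ) : R.B 1 i = filt J (R.Q 1) (i + 1) := by
  refine le_antisymm (R.B_le_filt 0 i) fun x hx => R.mem_B_of_mem_filt ?_ hx
  have : R.D 0 x ∈ R.B 0 (i + 1) := ⟨x, hx, rfl⟩
  rwa [B_zero_succ, Submodule.mem_bot] at this

/-- The inclusion `B → J Q` induces an injection of the associated graded modules. -/
theorem exists_gr_inclusion (m i : ℕ) :
    ∃ f : SubQuot (R.B (m + 1) i) (R.B (m + 1) (i + 1)) →ₗ[A] Gr J (R.Q (m + 1)) (i + 1),
      Function.Injective f ∧ f ∘ₗ Submodule.mkQ _ =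
        Submodule.mkQ _ ∘ₗ Submodule.inclusion (R.B_le_filt m i) := by
  refine ⟨Submodule.mapQ _ _ (Submodule.inclusion (R.B_le_filt m i)) fun x hx =>
    R.B_le_filt m (i + 1) hx, mapQ_injective _ ?_, rfl⟩
  rintro ⟨_, q, hq, rfl⟩ hx
  exact R.mem_B_of_mem_filt ((R.exact m).apply_apply_eq_zero q) hx

theorem isKilled_gr (X : Type u) [AddCommGroup X] [Module A X] (i : ℕ) : IsKilled J (Gr J X i) :=
  SubQuot.isKilled le_rfl

variable (hJ : J.IsTwoSided) (hI : IsRelInjective J (A ⧸ J))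

theorem filt_one (hJ : J.IsTwoSided) : filt J A 1 = J := Ideal.mul_top J

/-- The canonical isomorphism `A / J ≃ J⁰ / J¹`. -/
def grZeroEquiv (hJ : J.IsTwoSided) : (A ⧸ J) ≃ₗ[A] Gr J A 0 :=
  .ofBijective (Submodule.mapQ J ((filt J A 1).submoduleOf (filt J A 0))
    (LinearMap.codRestrict (filt J A 0) LinearMap.id fun _ => trivial) fun _ hx => (filt_one hJ).ge hx)
    ⟨mapQ_injective _ fun _ hx => (filt_one hJ).le hx, mapQ_surjective _ fun x => ⟨x, rfl⟩⟩

include hJ in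
theorem inAdd_gr_zero : InAdd (A := A) (A ⧸ J) (Gr J A 0) :=
  .of_bijective (grZeroEquiv hJ).toLinearMap (grZeroEquiv hJ).bijective

-- There are short exact sequences from `B (m + 1) i / B (m + 1) (i + 1)` through `Gr (i + 1)` of `Q
-- (m + 1)` to `B m (i + 1) / B m (i + 2)`. By induction the left term is a summand of a power of `A
-- / J`, hence relatively injective, and the sequence splits. All `m` are treated at once because a
-- step at `m` uses the cases `m + 1` and `1`.
include hJ hI in
theorem inAdd_subQuot_B (i m : ℕ) :
    InAdd (A := A) (A ⧸ J) (SubQuot (R.B m i) (R.B m (i + 1))) := by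
  induction i generalizing m with
  | zero =>
    -- The kernel of the differential lies in `J Q`, so the first quotient of the image is `Q / J
    -- Q`.
    refine (inAdd_gr_zero hJ).trans (((R.inAdd m).gr 0).trans (.of_bijective
      (Submodule.mapQ _ _ (R.toB m 0) fun x hx => Submodule.mem_map_of_mem hx)
      ⟨mapQ_injective _ ?_, mapQ_surjective _ (R.toB_surjective m 0)⟩))
    · rintro x ⟨y, hy, hxy⟩
      have h0 : R.D m ((x : R.Q (m + 1)) - y) = 0 := by
        rw [map_sub, hxy]
        exact sub_self _
      obtain ⟨q, hq⟩ := (R.exact m _).mp h0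
      rw [mem_submoduleOf, ← sub_add_cancel (x : R.Q (m + 1)) y]
      refine add_mem ?_ hy
      rw [← hq]
      exact R.mem_filt_one m q
  | succ i ih =>
    have hQ : InAdd (A := A) (A ⧸ J) (Gr J (R.Q (m + 1)) (i + 1)) := by
      -- The case `m = 1` is about `Jⁱ⁺¹ Q₁ / Jⁱ⁺² Q₁`, and `Q (m + 1)` is a summand of a power of
      -- `Q₁`.
      have h1 := ih 1
      rw [B_one, B_one] at h1
      exact h1.trans ((R.inAdd_one.trans (R.inAdd m)).gr (i + 1))
    obtain ⟨f, hf, hfq⟩ := R.exists_gr_inclusion m i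
    obtain ⟨ρ, hρ⟩ := (hI.of_inAdd (ih (m + 1))) f hf (isKilled_gr _ _) LinearMap.id
    let g : Gr J (R.Q (m + 1)) (i + 1) →ₗ[A] SubQuot (R.B m (i + 1)) (R.B m (i + 1 + 1)) :=
      Submodule.mapQ _ _ (R.toB m (i + 1)) fun x hx => Submodule.mem_map_of_mem hx
    have hg : Function.Surjective g := mapQ_surjective _ (R.toB_surjective m (i + 1))
    have hfg : Function.Exact f g := by
      intro y
      obtain ⟨x, rfl⟩ := Submodule.mkQ_surjective _ y
      constructor
      · intro h
        obtain ⟨y, hy, hxy⟩ := (Submodule.Quotient.mk_eq_zero _).mp h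
        have h0 : R.D m ((x : R.Q (m + 1)) - y) = 0 := by
          rw [map_sub, hxy]
          exact sub_self _
        have hB := R.mem_B_of_mem_filt h0 (sub_mem x.2 (filt_succ_le J _ hy))
        refine ⟨Submodule.Quotient.mk ⟨_, hB⟩, (LinearMap.congr_fun hfq ⟨_, hB⟩).trans ?_⟩
        refine (Submodule.Quotient.eq _).mpr ?_
        rw [mem_submoduleOf]
        simpa using hy
      · rintro ⟨z, hz⟩
        obtain ⟨⟨_, q, hq, rfl⟩, rfl⟩ := Submodule.mkQ_surjective _ z
        rw [← hz]
        refine (congrArg g (LinearMap.congr_fun hfq _)).trans ?_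
        refine (Submodule.Quotient.mk_eq_zero _).mpr ?_
        rw [mem_submoduleOf]
        simp only [coe_toB]
        have := (R.exact m).apply_apply_eq_zero q
        erw [this]
        exact zero_mem _
    have hsplit : (Function.Surjective g ∧ ∃ l, l ∘ₗ f = LinearMap.id) ↔
        (Function.Injective f ∧ ∃ l, g ∘ₗ l = LinearMap.id) := hfg.split_tfae'.out 1 0
    obtain ⟨-, s, hs⟩ := hsplit.mp ⟨hg, ρ, hρ⟩
    exact hQ.trans (.of_retract s g hs)

variable {N : ModuleCat.{u} A}

-- A class that dies on the next step comes from the quotient of the two steps. By relative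
-- injectivity this quotient is a retract of `Gr (i + 1)` of `Q (m + 1)`, and the retraction extends
-- the class to `Jⁱ⁺¹ Q`.
include hJ hI in
theorem exists_pull_inclusion {n m i : ℕ}
    (e : Abelian.Ext.{u} (ModuleCat.of A (R.B (m + 1) i)) N n)
    (he : pull (Submodule.inclusion (R.B_succ_le (m + 1) i)) e = 0) :
    ∃ e' : Abelian.Ext.{u} (ModuleCat.of A (filt J (R.Q (m + 1)) (i + 1))) N n,
      pull (Submodule.inclusion (R.B_le_filt m i)) e' = e := by
  obtain ⟨v, hv⟩ := (SubQuot.isSES (R.B_succ_le (m + 1) i)).exists_pull_right e he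
  obtain ⟨f, hf, hfq⟩ := R.exists_gr_inclusion m i
  obtain ⟨ρ, hρ⟩ := (hI.of_inAdd (R.inAdd_subQuot_B hJ hI i (m + 1))) f hf (isKilled_gr _ _)
    LinearMap.id
  refine ⟨pull (ρ ∘ₗ Submodule.mkQ _) v, ?_⟩
  rw [pull_pull, LinearMap.comp_assoc, ← hfq, ← LinearMap.comp_assoc, hρ, LinearMap.id_comp, hv]

/-- In degree zero a class is a homomorphism, and a homomorphism into a module killed by `J`
vanishes on `J L`. -/
theorem pull_zero_of_isKilled (hN : IsKilled J N) {X : Type u} [AddCommGroup X] [Module A X]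
    {L L' : Submodule A X} (hL : L' ≤ J • L) (h : L' ≤ L)
    (e : Abelian.Ext.{u} (ModuleCat.of A L) N 0) : pull (Submodule.inclusion h) e = 0 := by
  obtain ⟨f, rfl⟩ := (Abelian.Ext.mk₀_bijective _ _).2 e
  rw [pull, Abelian.Ext.mk₀_comp_mk₀]
  refine (Abelian.Ext.mk₀_eq_zero_iff _).mpr ?_
  ext ⟨x, hx⟩
  change f.hom ⟨x, h hx⟩ = 0
  have key : ∀ y ∈ J • L, ∃ hy : y ∈ L, f.hom ⟨y, hy⟩ = 0 := by
    intro y hy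
    refine Submodule.smul_induction_on hy (fun a ha z hz => ?_) ?_
    · refine ⟨L.smul_mem a hz, ?_⟩
      have := f.hom.map_smul a ⟨z, hz⟩
      exact this.trans (hN a ha _)
    · rintro y z ⟨hy, hy'⟩ ⟨hz, hz'⟩
      refine ⟨add_mem hy hz, ?_⟩
      have := f.hom.map_add ⟨y, hy⟩ ⟨z, hz⟩
      rw [hy', hz', add_zero] at this
      exact this
  exact (key x (hL hx)).2

theorem pull_inclusion_congr {X : Type u} [AddCommGroup X] [Module A X] {L L' K K' : Submodule A X}
    {n : ℕ} (hL : L = K) (hL' : L' = K') (h : L' ≤ L) (h' : K' ≤ K)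
    (H : ∀ e : Abelian.Ext.{u} (ModuleCat.of A L) N n, pull (Submodule.inclusion h) e = 0)
    (e : Abelian.Ext.{u} (ModuleCat.of A K) N n) : pull (Submodule.inclusion h') e = 0 := by
  subst hL hL'
  exact H e

-- Induction on `n`, and inside it on `i`. Classes on `B m (i + 1)` are detected after pulling back
-- to `Jⁱ⁺¹ Q`, and there the restricted class factors through the restriction from `Jⁱ Q` to `Jⁱ⁺¹
-- Q`. For `i = 0` it passes through `Ext` of a projective; for larger `i` that restriction is the
-- case `m = 1` one step lower.
include hJ hI in
theorem pull_B_eq_zero (hN : IsKilled J N) (n i m : ℕ)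
    (e : Abelian.Ext.{u} (ModuleCat.of A (R.B m i)) N n) :
    pull (Submodule.inclusion (R.B_succ_le m i)) e = 0 := by
  induction n generalizing i m with
  | zero => exact pull_zero_of_isKilled hN (R.B_succ m i).le _ e
  | succ n ihn =>
    /- a class killed in `Ext(Jⁱ⁺¹ Q)` comes from `Ext(B)`, hence vanishes -/
    have key : ∀ (i m : ℕ) (y : Abelian.Ext.{u} (ModuleCat.of A (R.B m (i + 1))) N (n + 1)),
        pull (R.toB m (i + 1)) y = 0 → y = 0 := by
      intro i m y hy
      obtain ⟨v, rfl⟩ := (R.isSES m (i + 1)).exists_extClass_comp y hy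
      obtain ⟨v', rfl⟩ := R.exists_pull_inclusion hJ hI v (ihn _ _ v)
      exact (R.isSES m (i + 1)).extClass_comp_pull v' _
    induction i generalizing m with
    | zero =>
      apply key
      rw [pull_pull]
      have h1 : Submodule.inclusion (R.B_succ_le m 0) ∘ₗ R.toB m (0 + 1) =
          R.toB m 0 ∘ₗ Submodule.inclusion (filt_succ_le J 0) := rfl
      rw [h1, ← pull_pull, ext_filt_zero_eq_zero (R.inAdd m) (pull _ e), pull_zero_right]
    | succ i ihi =>
      apply key
      rw [pull_pull]
      have h1 : Submodule.inclusion (R.B_succ_le m (i + 1)) ∘ₗ R.toB m (i + 1 + 1) =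
          R.toB m (i + 1) ∘ₗ Submodule.inclusion (filt_succ_le J (i + 1)) := rfl
      rw [h1, ← pull_pull]
      apply pull_filt_eq_zero_of_inAdd (R.inAdd_one.trans (R.inAdd m))
      -- From its first step on, the filtration of `Q₁` is that of `B 1`, so the inner hypothesis
      -- applies with `m = 1`.
      exact pull_inclusion_congr (R.B_one i) (R.B_one (i + 1)) _ _ (ihi 1)

include R hJ hI in
theorem inAdd_gr (i : ℕ) : InAdd (A := A) (A ⧸ J) (Gr J A i) := by
  cases i with
  | zero => exact inAdd_gr_zero hJ
  | succ i =>
    have h1 := R.inAdd_subQuot_B hJ hI i 1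
    rw [B_one, B_one] at h1
    exact h1.trans (R.inAdd_one.gr (i + 1))

include R hJ hI in
theorem pull_filt_eq_zero (hN : IsKilled J N) (n i : ℕ)
    (e : Abelian.Ext.{u} (ModuleCat.of A (filt J A i)) N n) :
    pull (Submodule.inclusion (filt_succ_le J i)) e = 0 := by
  cases i with
  | zero =>
    cases n with
    | zero => exact pull_zero_of_isKilled hN le_rfl _ e
    | succ n =>
      rw [ext_filt_zero_eq_zero .of_finite_projective e, pull_zero_right]
  | succ i =>
    exact pull_filt_eq_zero_of_inAdd R.inAdd_one (pull_inclusion_congr (R.B_one i)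
      (R.B_one (i + 1)) _ _ (R.pull_B_eq_zero hJ hI hN n i 1)) e

end LinearResolution

end LinearResolution

/-! ### Splicing the long exact sequences of the `J`-adic filtration of `A`. -/

section GrClass

open Abelian

variable {A : Type u} [Ring A] (J : Ideal A)

/-- The short exact sequence `Jⁱ⁺¹ → Jⁱ → Jⁱ / Jⁱ⁺¹`. -/
theorem gr_isSES (i : ℕ) :
    IsSES (Submodule.inclusion (filt_succ_le J (X := A) i))
      ((filt J A (i + 1)).submoduleOf (filt J A i)).mkQ :=
  SubQuot.isSES _

/-- The class in `Ext¹(Jⁱ / Jⁱ⁺¹, Jⁱ⁺¹ / Jⁱ⁺²)` of the extension `Jⁱ / Jⁱ⁺²`. -/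
def grClass (i : ℕ) : Ext.{u} (ModuleCat.of A (Gr J A i)) (ModuleCat.of A (Gr J A (i + 1))) 1 :=
  (gr_isSES J i).extClass.comp (Ext.mk₀ (ModuleCat.ofHom (Submodule.mkQ _))) (add_zero 1)

variable {J} {N : ModuleCat.{u} A}

theorem grClass_comp {n i m : ℕ} (e : Ext.{u} (ModuleCat.of A (Gr J A (i + 1))) N n)
    (h : 1 + n = m) :
    (grClass J i).comp e h = (gr_isSES J i).extClass.comp (pull (Submodule.mkQ _) e) h :=
  Ext.comp_assoc _ _ _ _ _ (by omega)

theorem grClass_comp_grClass_comp {n i m p : ℕ}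
    (e : Ext.{u} (ModuleCat.of A (Gr J A (i + 2))) N n) (h : 1 + n = m) (h' : 1 + m = p) :
    (grClass J i).comp ((grClass J (i + 1)).comp e h) h' = 0 := by
  rw [grClass_comp, grClass_comp, IsSES.pull_extClass_comp, Ext.comp_zero]

/-- Since `A` is projective, the class is a connecting image from `J`; the class found there
restricts to zero on `J²`, so it comes from `J / J²`. -/
theorem exists_grClass_zero_comp {n : ℕ} (e : Ext.{u} (ModuleCat.of A (Gr J A 0)) N (n + 1))
    (hN : ∀ (n i : ℕ) (e : Ext.{u} (ModuleCat.of A (filt J A i)) N n),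
      pull (Submodule.inclusion (filt_succ_le J i)) e = 0) :
    ∃ e', (grClass J 0).comp e' (add_comm 1 n) = e := by
  obtain ⟨v, rfl⟩ := (gr_isSES J 0).exists_extClass_comp e
    (ext_filt_zero_eq_zero .of_finite_projective _)
  obtain ⟨v', rfl⟩ := (gr_isSES J 1).exists_pull_right v (hN _ _ _)
  exact ⟨v', grClass_comp _ _⟩

/-- If the connecting image vanishes, the pulled back class extends from `Jⁱ⁺¹` to `Jⁱ`; but
restriction from `Jⁱ` is zero. -/
theorem pull_mkQ_eq_zero {n i : ℕ} (e : Ext.{u} (ModuleCat.of A (Gr J A (i + 1))) N n)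
    (hN : ∀ (n i : ℕ) (e : Ext.{u} (ModuleCat.of A (filt J A i)) N n),
      pull (Submodule.inclusion (filt_succ_le J i)) e = 0)
    (he : (grClass J i).comp e (add_comm 1 n) = 0) :
    pull (Submodule.mkQ ((filt J A (i + 1 + 1)).submoduleOf (filt J A (i + 1)))) e = 0 := by
  rw [grClass_comp] at he
  obtain ⟨v, hv⟩ := (gr_isSES J i).exists_pull_left _ he
  rw [← hv]
  exact hN _ _ v

theorem grClass_comp_injective_zero {i : ℕ} (e : Ext.{u} (ModuleCat.of A (Gr J A (i + 1))) N 0)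
    (hN : ∀ (n i : ℕ) (e : Ext.{u} (ModuleCat.of A (filt J A i)) N n),
      pull (Submodule.inclusion (filt_succ_le J i)) e = 0)
    (he : (grClass J i).comp e (add_comm 1 0) = 0) : e = 0 :=
  (gr_isSES J (i + 1)).pull_injective_zero e (pull_mkQ_eq_zero e hN he)

/-- The argument of `exists_grClass_zero_comp`, with the vanishing in `pull_mkQ_eq_zero` replacing
projectivity of `A`. -/
theorem exists_grClass_succ_comp {n i : ℕ}
    (e : Ext.{u} (ModuleCat.of A (Gr J A (i + 1))) N (n + 1))
    (hN : ∀ (n i : ℕ) (e : Ext.{u} (ModuleCat.of A (filt J A i)) N n),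
      pull (Submodule.inclusion (filt_succ_le J i)) e = 0)
    (he : (grClass J i).comp e (add_comm 1 (n + 1)) = 0) :
    ∃ e', (grClass J (i + 1)).comp e' (add_comm 1 n) = e := by
  obtain ⟨v, rfl⟩ := (gr_isSES J (i + 1)).exists_extClass_comp e (pull_mkQ_eq_zero e hN he)
  obtain ⟨v', rfl⟩ := (gr_isSES J (i + 2)).exists_pull_right v (hN _ _ _)
  exact ⟨v', grClass_comp _ _⟩

end GrClass

/-! ### Degree filtration versus radical filtration; self-injectivity of `A₀`. -/

section GradedModules

variable {k : Type w} [Field k] {A : Type u} [Ring A] [Algebra k A] {𝒜 : ℕ → Submodule k A}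

namespace GrModule

variable (M : GrModule 𝒜)

instance : DirectSum.Decomposition M.deg := M.isInternal.chooseDecomposition

/-- The projection of a graded module onto its component of degree `j`. -/
def proj (j : ℤ) : M.carrier →ₗ[k] M.carrier :=
  (M.deg j).subtype ∘ₗ DirectSum.component k ℤ _ j ∘ₗ
    (DirectSum.decomposeLinearEquiv M.deg).toLinearMap

theorem proj_mem (j : ℤ) (x : M.carrier) : M.proj j x ∈ M.deg j := Subtype.prop _

variable {M}

theorem proj_of_mem {j : ℤ} {x : M.carrier} (hx : x ∈ M.deg j) : M.proj j x = x :=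
  DirectSum.decompose_of_mem_same _ hx

theorem proj_of_mem_ne {i j : ℤ} {x : M.carrier} (hx : x ∈ M.deg i) (h : i ≠ j) :
    M.proj j x = 0 :=
  DirectSum.decompose_of_mem_ne _ hx h

theorem exists_eq_sum_proj (x : M.carrier) : ∃ s : Finset ℤ, x = ∑ j ∈ s, M.proj j x := by
  classical
  exact ⟨_, (DirectSum.sum_support_decompose M.deg x).symm⟩

theorem proj_smul {i : ℕ} {a : A} (ha : a ∈ 𝒜 i) (j : ℤ) (x : M.carrier) :
    M.proj j (a • x) = a • M.proj (j - i) x := by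
  induction x using DirectSum.Decomposition.inductionOn M.deg with
  | zero => simp
  | add x y hx hy => rw [smul_add, map_add, map_add, smul_add, hx, hy]
  | homogeneous x =>
    rename_i l
    by_cases h : l = j - i
    · subst h
      rw [proj_of_mem x.2]
      refine proj_of_mem ?_
      have := M.smul_mem ha x.2
      rwa [add_sub_cancel] at this
    · rw [proj_of_mem_ne x.2 h, proj_of_mem_ne (M.smul_mem ha x.2) (by omega), smul_zero]

theorem IsGradedHom.proj {M N : GrModule 𝒜} {f : M.carrier →ₗ[A] N.carrier}
    (hf : GrModule.IsGradedHom f) (j : ℤ) (x : M.carrier) : f (M.proj j x) = N.proj j (f x) := by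
  induction x using DirectSum.Decomposition.inductionOn M.deg with
  | zero => simp
  | add x y hx hy => rw [map_add, map_add, map_add, map_add, hx, hy]
  | homogeneous x =>
    rename_i l
    by_cases h : l = j
    · subst h
      rw [proj_of_mem x.2, proj_of_mem (hf _ _ x.2)]
    · rw [proj_of_mem_ne x.2 h, proj_of_mem_ne (hf _ _ x.2) h, map_zero]

theorem finite_of_isGeneratedIn {s : ℤ} (hM : M.IsLocallyFinite) (hs : M.IsGeneratedIn s) :
    Module.Finite A M.carrier := by
  obtain ⟨t, ht⟩ := (Module.Finite.iff_fg.mp (hM s))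
  refine ⟨⟨t, ?_⟩⟩
  rw [eq_top_iff, ← hs, Submodule.span_le]
  intro x hx
  rw [← ht] at hx
  have : Submodule.span k (t : Set M.carrier) ≤
      (Submodule.span A (t : Set M.carrier)).restrictScalars k :=
    Submodule.span_le.mpr Submodule.subset_span
  exact this hx

/-- Projecting an `A`-combination of elements of `M_s` to degree `j` leaves only products from `Aₙ
M_s` with `s + n = j`. -/
theorem deg_induction {s : ℤ} (hs : M.IsGeneratedIn s) [GradedAlgebra 𝒜] (W : AddSubgroup M.carrier)
    {j : ℤ} (hW : ∀ (n : ℕ) (a : A) (m : M.carrier), s + n = j → a ∈ 𝒜 n → m ∈ M.deg s → a • m ∈ W)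
    {x : M.carrier} (hx : x ∈ M.deg j) : x ∈ W := by
  suffices h : ∀ y : M.carrier, M.proj j y ∈ W by
    rw [← proj_of_mem hx]
    exact h x
  intro y
  have hy : y ∈ Submodule.span A (M.deg s : Set M.carrier) := by rw [hs]; trivial
  induction hy using Submodule.closure_induction with
  | zero => rw [map_zero]; exact W.zero_mem
  | add x y _ _ hx hy => rw [map_add]; exact W.add_mem hx hy
  | smul_mem a m hm =>
    induction a using DirectSum.Decomposition.inductionOn 𝒜 with
    | zero => rw [zero_smul, map_zero]; exact W.zero_mem
    | add a b ha hb => rw [add_smul, map_add]; exact W.add_mem ha hb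
    | homogeneous a =>
      rename_i n
      rw [proj_smul a.2]
      by_cases h : s + n = j
      · rw [show j - n = s by omega, proj_of_mem hm]
        exact hW n a m h a.2 hm
      · rw [proj_of_mem_ne hm (by omega), smul_zero]
        exact W.zero_mem

variable (M) in
/-- The submodule of elements whose components of degree less than `t` vanish. -/
def above [GradedAlgebra 𝒜] (t : ℤ) : Submodule A M.carrier where
  carrier := {x | ∀ j < t, M.proj j x = 0}
  add_mem' hx hy j hj := by rw [map_add, hx j hj, hy j hj, add_zero]
  zero_mem' j _ := map_zero _
  smul_mem' a x hx j hj := by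
    induction a using DirectSum.Decomposition.inductionOn 𝒜 with
    | zero => rw [zero_smul, map_zero]
    | add a b ha hb => rw [add_smul, map_add, ha, hb, add_zero]
    | homogeneous a => rw [proj_smul a.2, hx _ (by omega), smul_zero]

end GrModule

variable (𝒜) [GradedAlgebra 𝒜]

theorem mem_positiveIdeal {a : A} : a ∈ positiveIdeal 𝒜 ↔ (DirectSum.decompose 𝒜 a 0 : A) = 0 :=
  HomogeneousIdeal.mem_irrelevant_iff 𝒜 a

theorem mem_positiveIdeal_of_mem {a : A} {n : ℕ} (ha : a ∈ 𝒜 n) (hn : n ≠ 0) :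
    a ∈ positiveIdeal 𝒜 :=
  (mem_positiveIdeal 𝒜).mpr (DirectSum.decompose_of_mem_ne 𝒜 ha hn)

theorem eq_zero_of_mem_positiveIdeal {a : A} (ha : a ∈ 𝒜 0) (h : a ∈ positiveIdeal 𝒜) : a = 0 := by
  rw [mem_positiveIdeal, DirectSum.decompose_of_mem_same 𝒜 ha] at h
  exact h

theorem sub_decompose_zero_mem (a : A) :
    a - (DirectSum.decompose 𝒜 a 0 : A) ∈ positiveIdeal 𝒜 := by
  rw [mem_positiveIdeal, DirectSum.decompose_sub, DirectSum.sub_apply, Submodule.coe_sub,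
    DirectSum.decompose_of_mem_same 𝒜 (DirectSum.decompose 𝒜 a 0).2, sub_self]

instance positiveIdeal_isTwoSided : Ideal.IsTwoSided (positiveIdeal 𝒜) where
  mul_mem_of_left {a} b ha := by
    have h := HomogeneousIdeal.toIdeal_irrelevant 𝒜
    rw [positiveIdeal, h, RingHom.mem_ker] at ha ⊢
    rw [map_mul, ha, zero_mul]

theorem isKilled_quotient_positiveIdeal : IsKilled (positiveIdeal 𝒜) (A ⧸ positiveIdeal 𝒜) := by
  intro a ha x
  obtain ⟨b, rfl⟩ := Submodule.Quotient.mk_surjective _ x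
  rw [← Submodule.Quotient.mk_smul]
  exact (Submodule.Quotient.mk_eq_zero _).mpr (Ideal.mul_mem_right b _ ha)

variable {𝒜}

theorem positiveIdeal_smul_above_le (M : GrModule 𝒜) (t : ℤ) :
    positiveIdeal 𝒜 • M.above t ≤ M.above (t + 1) := by
  rw [Submodule.smul_le]
  intro a ha x hx j hj
  have key : ∀ b : A, M.proj j (b • x) = M.proj j ((DirectSum.decompose 𝒜 b 0 : A) • x) := by
    intro b
    induction b using DirectSum.Decomposition.inductionOn 𝒜 with
    | zero => simp
    | add b c hb hc =>
      rw [add_smul, map_add, hb, hc, DirectSum.decompose_add, DirectSum.add_apply,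
        Submodule.coe_add, add_smul, map_add]
    | homogeneous b =>
      rename_i n
      by_cases hn : n = 0
      · subst hn
        rw [DirectSum.decompose_of_mem_same 𝒜 b.2]
      · rw [DirectSum.decompose_of_mem_ne 𝒜 b.2 hn, zero_smul, map_zero, GrModule.proj_smul b.2,
          hx _ (by omega), smul_zero]
  rw [key, (mem_positiveIdeal 𝒜).mp ha, zero_smul, map_zero]

/-- For a module generated in degree `s` over an algebra generated in degrees `0` and `1`, the
radical filtration is the filtration by degree. -/
theorem filt_eq_above (hmul : ∀ i j, 𝒜 i * 𝒜 j = 𝒜 (i + j)) {M : GrModule 𝒜} {s : ℤ}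
    (hs : M.IsGeneratedIn s) (i : ℕ) : filt (positiveIdeal 𝒜) M.carrier i = M.above (s + i) := by
  induction i with
  | zero =>
    refine le_antisymm ?_ le_top
    change ⊤ ≤ _
    rw [← hs, Submodule.span_le]
    intro x hx j hj
    exact GrModule.proj_of_mem_ne hx (by omega)
  | succ i ih =>
    rw [filt, ih]
    refine le_antisymm ((positiveIdeal_smul_above_le M _).trans_eq (by push_cast; ring_nf)) ?_
    intro x hx
    obtain ⟨t, ht⟩ := M.exists_eq_sum_proj x
    rw [ht]
    refine Submodule.sum_mem _ fun j _ => ?_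
    by_cases hj : j < s + (i + 1 : ℕ)
    · rw [hx j hj]
      exact zero_mem _
    refine GrModule.deg_induction hs (positiveIdeal 𝒜 • M.above (s + i)).toAddSubgroup ?_
      (M.proj_mem j x)
    intro n a m hn ha hm
    -- Here `n ≥ i + 1`, so a factor of degree one splits off on the left; it lies in `J`, and the
    -- other factor still raises the degree to at least `s + i`.
    rw [show n = 1 + (n - 1) by omega, ← hmul] at ha
    change a • m ∈ positiveIdeal 𝒜 • M.above (s + i)
    induction ha using Submodule.mul_induction_on' with
    | mem_mul_mem b hb c hc =>
      rw [mul_smul]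
      refine Submodule.smul_mem_smul (mem_positiveIdeal_of_mem 𝒜 hb one_ne_zero) ?_
      intro l hl
      exact GrModule.proj_of_mem_ne (M.smul_mem hc hm) (by omega)
    | add a _ b _ ha hb =>
      rw [add_smul]
      exact add_mem ha hb

/-- Over `𝒜 0` the module `A / J` is the regular one, hence injective. Any `𝒜 0`-linear extension is
already `A`-linear, because `J` kills both `Z` and `A / J`. -/
theorem isRelInjective_of_isSelfInjective (hI : IsSelfInjective (𝒜 0)) :
    IsRelInjective (positiveIdeal 𝒜) (A ⧸ positiveIdeal 𝒜) := by
  intro Y Z _ _ _ _ f hf hZ g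
  let φ : 𝒜 0 →+* A :=
    { toFun := Subtype.val
      map_one' := rfl
      map_mul' := fun _ _ => rfl
      map_zero' := rfl
      map_add' := fun _ _ => rfl }
  let _ : Module (𝒜 0) Y := Module.compHom Y φ
  let _ : Module (𝒜 0) Z := Module.compHom Z φ
  let _ : Module (𝒜 0) (A ⧸ positiveIdeal 𝒜) := Module.compHom _ φ
  let T : 𝒜 0 →ₗ[𝒜 0] (A ⧸ positiveIdeal 𝒜) :=
    { toFun := fun a => Submodule.Quotient.mk (a : A)
      map_add' := fun _ _ => rfl
      map_smul' := fun _ _ => rfl }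
  have hT : Function.Bijective T := by
    constructor
    · rw [injective_iff_map_eq_zero]
      intro a ha
      exact Subtype.ext (eq_zero_of_mem_positiveIdeal 𝒜 a.2
        ((Submodule.Quotient.mk_eq_zero _).mp ha))
    · intro x
      obtain ⟨a, rfl⟩ := Submodule.Quotient.mk_surjective _ x
      exact ⟨_, ((Submodule.Quotient.eq _).mpr (sub_decompose_zero_mem 𝒜 a)).symm⟩
  let T' := LinearEquiv.ofBijective T hT
  let f₀ : Y →ₗ[𝒜 0] Z := { f with map_smul' := fun a y => f.map_smul (φ a) y }
  let g₀ : Y →ₗ[𝒜 0] (A ⧸ positiveIdeal 𝒜) := { g with map_smul' := fun a y => g.map_smul (φ a) y }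
  obtain ⟨h, hh⟩ := (hI (𝒜 0) inferInstance inferInstance).out f₀ hf (T'.symm.toLinearMap ∘ₗ g₀)
  refine ⟨{ toFun := fun z => T (h z), map_add' := fun x y => by simp, map_smul' := ?_ }, ?_⟩
  · intro a z
    have h1 : a • z = (DirectSum.decompose 𝒜 a 0) • z := by
      rw [← sub_eq_zero]
      refine Eq.trans ?_ (hZ _ (sub_decompose_zero_mem 𝒜 a) z)
      rw [sub_smul]
      rfl
    have h2 : ∀ s : A ⧸ positiveIdeal 𝒜, a • s = (DirectSum.decompose 𝒜 a 0) • s := by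
      intro s
      rw [← sub_eq_zero]
      refine Eq.trans ?_ (isKilled_quotient_positiveIdeal 𝒜 _ (sub_decompose_zero_mem 𝒜 a) s)
      rw [sub_smul]
      rfl
    rw [h1, map_smul, map_smul, RingHom.id_apply, h2]
  · ext y
    exact (congrArg T (hh y)).trans (T'.apply_symm_apply (g y))

end GradedModules

/-! ### From a linear projective resolution of `A₀` to a `LinearResolution`. -/

section KoszulAlgebras

variable {k : Type w} [Field k] {A : Type u} [Ring A] [Algebra k A] {𝒜 : ℕ → Submodule k A}
  [GradedAlgebra 𝒜]

theorem mem_filt_one_of_linear {M N : GrModule 𝒜} {d : M.carrier →ₗ[A] N.carrier}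
    (hmul : ∀ i j, 𝒜 i * 𝒜 j = 𝒜 (i + j)) {s : ℤ} (hM : M.IsGeneratedIn (s + 1))
    (hN : N.IsGeneratedIn s) (hd : GrModule.IsGradedHom d) (x : M.carrier) :
    d x ∈ filt (positiveIdeal 𝒜) N.carrier 1 := by
  rw [filt_eq_above hmul hN]
  have hx : x ∈ filt (positiveIdeal 𝒜) M.carrier 0 := trivial
  rw [filt_eq_above hmul hM] at hx
  intro j hj
  rw [← hd.proj, hx j (by push_cast at *; omega), map_zero]

/-- Drop the components of `x` below degree `s + 1 + i`: they map to zero, as `d x` lives in degrees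
at least `s + i + 1`. The generating degrees differ by one, which is the shift in the filtration. -/
theorem exists_mem_filt_of_linear {M N : GrModule 𝒜} {d : M.carrier →ₗ[A] N.carrier}
    (hmul : ∀ i j, 𝒜 i * 𝒜 j = 𝒜 (i + j)) {s : ℤ} (hM : M.IsGeneratedIn (s + 1))
    (hN : N.IsGeneratedIn s) (hd : GrModule.IsGradedHom d) {i : ℕ} {x : M.carrier}
    (hx : d x ∈ filt (positiveIdeal 𝒜) N.carrier (i + 1)) :
    ∃ y ∈ filt (positiveIdeal 𝒜) M.carrier i, d y = d x := by
  classical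
  rw [filt_eq_above hmul hN] at hx
  rw [filt_eq_above hmul hM]
  obtain ⟨t, ht⟩ := M.exists_eq_sum_proj x
  refine ⟨∑ j ∈ t with s + 1 + i ≤ j, M.proj j x, ?_, ?_⟩
  · refine Submodule.sum_mem _ fun j hj l hl => ?_
    exact GrModule.proj_of_mem_ne (M.proj_mem j x) (by rw [Finset.mem_filter] at hj; omega)
  · conv_rhs => rw [ht]
    rw [map_sum, map_sum]
    refine Finset.sum_filter_of_ne fun j _ hj => ?_
    by_contra hlt
    exact hj (by rw [hd.proj]; exact hx j (by push_cast; omega))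

variable (𝒜) in
/-- The projection `A → A₀ = A / J`. -/
def toDegreeZero : A →ₗ[A] (degreeZeroModule 𝒜).carrier := Submodule.mkQ (positiveIdeal 𝒜)

theorem toDegreeZero_surjective : Function.Surjective (toDegreeZero 𝒜) :=
  Submodule.mkQ_surjective _

theorem toDegreeZero_eq_zero_iff {a : A} : toDegreeZero 𝒜 a = 0 ↔ a ∈ positiveIdeal 𝒜 :=
  Submodule.Quotient.mk_eq_zero _

theorem mem_degreeZeroModule_deg (x : (degreeZeroModule 𝒜).carrier) :
    x ∈ (degreeZeroModule 𝒜).deg 0 := by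
  have h : concentrated k (A ⧸ positiveIdeal 𝒜) 0 = ⊤ := by rw [concentrated, if_pos rfl]
  exact h.ge trivial

/-- The zeroth term of a linear projective resolution of `A₀` has `A` as a direct summand. -/
theorem inAdd_of_linear_cover (hmul : ∀ i j, 𝒜 i * 𝒜 j = 𝒜 (i + j))
    (hidem : ∀ a ∈ positiveIdeal 𝒜, a * a = a → a = 0) {P : GrModule 𝒜}
    [Module.Projective A P.carrier] (hP : P.IsGeneratedIn 0)
    {ε : P.carrier →ₗ[A] (degreeZeroModule 𝒜).carrier} (hε : GrModule.IsGradedHom ε)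
    (hsurj : Function.Surjective ε)
    (hker : ∀ x, ε x = 0 → x ∈ filt (positiveIdeal 𝒜) P.carrier 1) :
    InAdd (A := A) P.carrier A := by
  -- The kernel of `ε` lives in positive degrees, so `ε` is injective in degree zero.
  have hzero : ∀ x ∈ P.deg 0, ε x = 0 → x = 0 := by
    intro x hx h
    have := hker x h
    rw [filt_eq_above hmul hP] at this
    rw [← GrModule.proj_of_mem hx]
    exact this 0 (by norm_num)
  obtain ⟨q, hq⟩ := hsurj (toDegreeZero 𝒜 1)
  let p := P.proj 0 q
  have hp : ε p = toDegreeZero 𝒜 1 := by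
    rw [hε.proj, hq, GrModule.proj_of_mem (mem_degreeZeroModule_deg _)]
  let φ : A →ₗ[A] P.carrier := LinearMap.toSpanSingleton A _ p
  have hφa : ∀ a, φ a = a • p := fun a => LinearMap.toSpanSingleton_apply ..
  have hεφ : ∀ a, ε (φ a) = toDegreeZero 𝒜 a := by
    intro a
    rw [hφa, map_smul, hp, ← map_smul, smul_eq_mul, mul_one]
  have hφ : Function.Surjective φ := by
    rw [← LinearMap.range_eq_top, eq_top_iff, ← hP, Submodule.span_le]
    intro x hx
    obtain ⟨a, ha⟩ := toDegreeZero_surjective (ε x)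
    refine ⟨(DirectSum.decompose 𝒜 a 0 : A), ?_⟩
    rw [← sub_eq_zero]
    apply hzero
    · refine sub_mem ?_ hx
      have := P.smul_mem (DirectSum.decompose 𝒜 a 0).2 (P.proj_mem 0 q)
      rw [hφa]
      simpa using this
    · rw [map_sub, hεφ, ← ha, ← map_sub, toDegreeZero_eq_zero_iff, ← neg_mem_iff, neg_sub]
      exact sub_decompose_zero_mem 𝒜 a
  -- `P` is projective, so `φ` has a section `σ`. Then `1 - σ p` is an idempotent in `J`, hence
  -- zero, and `σ` is a left inverse of `φ` as well.
  obtain ⟨σ, hσ⟩ := Module.projective_lifting_property φ LinearMap.id hφ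
  have hσ' : ∀ x, φ (σ x) = x := fun x => LinearMap.congr_fun hσ x
  have hσφ : ∀ a, σ (φ a) = a * σ p := by
    intro a
    rw [hφa, map_smul, smul_eq_mul]
  have hφ1 : φ 1 = p := one_smul A p
  have hσp : σ p = 1 := by
    have h1 : 1 - σ p = 0 := by
      apply hidem
      · rw [← toDegreeZero_eq_zero_iff, map_sub, ← hεφ, ← hεφ, hφ1, hσ', sub_self]
      · have h2 : σ p * σ p = σ p := by rw [← hσφ, hσ']
        rw [mul_sub, sub_mul, sub_mul, h2]
        simp
    rw [sub_eq_zero] at h1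
    exact h1.symm
  refine .of_retract φ σ ?_
  ext
  rw [LinearMap.comp_apply, hφ1, hσp]
  rfl

/-- A linear projective resolution of `A₀`, augmented by `A₀`. -/
theorem IsKoszulAlgebra.exists_linearResolution (hA : IsKoszulAlgebra 𝒜)
    (hidem : ∀ a ∈ positiveIdeal 𝒜, a * a = a → a = 0) :
    Nonempty (LinearResolution (positiveIdeal 𝒜)) := by
  obtain ⟨-, -, P, d, ε, hproj, hfin, hgen, hd, hε, hεs, h0, hex⟩ := hA.koszul
  have hmul := hA.mul_eq
  have hgen' : ∀ i : ℕ, (P (i + 1)).IsGeneratedIn (i + 1) := fun i => by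
    have := hgen (i + 1)
    rwa [Nat.cast_succ] at this
  have hadd : ∀ i, InAdd (A := A) A (P i).carrier := fun i =>
    have := hproj i
    have := GrModule.finite_of_isGeneratedIn (hfin i) (hgen i)
    .of_finite_projective
  have hone : InAdd (A := A) (P 0).carrier A :=
    have := hproj 0
    inAdd_of_linear_cover hmul hidem (hgen 0) hε hεs fun x hx => by
      obtain ⟨y, rfl⟩ := (h0 x).mp hx
      exact mem_filt_one_of_linear hmul (hgen' 0) (hgen 0) (hd 0) y
  -- The index shifts by one: `Q 0` is `A₀`, `Q (m + 1)` is `P m`, and the zeroth differential is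
  -- the augmentation.
  exact ⟨{
    Q := fun | 0 => A ⧸ positiveIdeal 𝒜 | m + 1 => (P m).carrier
    addCommGroup := fun | 0 => inferInstance | m + 1 => (P m).addCommGroup
    module := fun | 0 => inferInstance | m + 1 => (P m).module
    D := fun | 0 => ε | m + 1 => d m
    exact := fun | 0 => h0 | m + 1 => hex m
    isKilled := isKilled_quotient_positiveIdeal 𝒜
    inAdd := hadd
    inAdd_one := hone
    mem_filt_one := fun m => mem_filt_one_of_linear hmul (hgen' m) (hgen m) (hd m)
    strict := fun m _ _ => exists_mem_filt_of_linear hmul (hgen' m) (hgen m) (hd m) }⟩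

end KoszulAlgebras

/-! ### Finite-dimensionality of `Ext`. -/

section FiniteExt

open Abelian ModuleCat

variable (k : Type w) [Field k] {A : Type u} [Ring A] [Algebra k A]

theorem finite_hom [Module.Finite k A] (X Y : ModuleCat.{u} A) [Module.Finite A X]
    [Module.Finite A Y] : Module.Finite k (X ⟶ Y) := by
  have : Module.Finite k X := Module.Finite.trans A X
  have : Module.Finite k Y := Module.Finite.trans A Y
  have : Module.Finite k (X →ₗ[A] Y) :=
    Module.Finite.of_injective (LinearMap.restrictScalarsₗ k A X Y k)
      (LinearMap.restrictScalars_injective k)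
  exact Module.Finite.equiv (ModuleCat.homLinearEquiv (S := k)).symm

/-- Dimension shifting along a finite free cover, whose kernel is finitely generated because `A` is
Noetherian. -/
theorem finite_ext [Module.Finite k A] (X Y : ModuleCat.{u} A) [Module.Finite A X]
    [Module.Finite A Y] (n : ℕ) : Module.Finite k (Ext.{u} X Y n) := by
  have : IsNoetherianRing A := isNoetherian_of_tower k inferInstance
  induction n generalizing X with
  | zero =>
    have := finite_hom k X Y
    exact Module.Finite.equiv (Ext.linearEquiv₀ (R := k)).symm
  | succ n ih =>
    obtain ⟨r, f, hf⟩ := Module.Finite.exists_fin' A X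
    let exac := LinearMap.shortExact_shortComplexKer hf
    have : Module.Finite A f.shortComplexKer.X₁ :=
      inferInstanceAs (Module.Finite A (LinearMap.ker f))
    have := ih f.shortComplexKer.X₁
    have : Projective f.shortComplexKer.X₂ :=
      (IsProjective.iff_projective (Fin r → A)).mp inferInstance
    have hs : Function.Surjective (exac.extClass.precompOfLinear k Y (add_comm 1 n)) :=
      precomp_extClass_surjective_of_projective_X₂ Y exac n
    exact Module.Finite.of_surjective _ hs

end FiniteExt

/-! ### Vanishing of `Ext` forced by an idempotent. -/

section Idempotents

open Abelian

variable {A : Type u} [Ring A] {e : A}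

/-- The left ideal `A e`. -/
def leftIdeal (e : A) : Submodule A A := LinearMap.range (LinearMap.toSpanSingleton A A e)

theorem mem_leftIdeal (he : e * e = e) {a : A} : a ∈ leftIdeal e ↔ a * e = a := by
  constructor
  · rintro ⟨b, rfl⟩
    rw [LinearMap.toSpanSingleton_apply, smul_eq_mul, mul_assoc, he]
  · intro h
    exact ⟨a, h⟩

/-- Right multiplication by `e`, as a map onto the left ideal `A e`. -/
def toLeftIdeal (e : A) : A →ₗ[A] leftIdeal e := (LinearMap.toSpanSingleton A A e).rangeRestrict

theorem toLeftIdeal_comp_subtype (he : e * e = e) :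
    toLeftIdeal e ∘ₗ (leftIdeal e).subtype = LinearMap.id := by
  ext ⟨a, ha⟩
  exact (mem_leftIdeal he).mp ha

theorem leftIdeal_projective (he : e * e = e) : Module.Projective A (leftIdeal e) :=
  .of_split _ _ (toLeftIdeal_comp_subtype he)

theorem leftIdeal_finsupp_projective (he : e * e = e) (X : Type u) :
    Module.Projective A (X →₀ leftIdeal e) :=
  .of_split (Finsupp.mapRange.linearMap (leftIdeal e).subtype)
    (Finsupp.mapRange.linearMap (toLeftIdeal e)) <| LinearMap.ext fun f => Finsupp.ext fun x =>
      LinearMap.congr_fun (toLeftIdeal_comp_subtype he) (f x)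

theorem isSES_ker {X Y : Type u} [AddCommGroup X] [Module A X] [AddCommGroup Y] [Module A Y]
    {f : X →ₗ[A] Y} (hf : Function.Surjective f) : IsSES (LinearMap.ker f).subtype f :=
  ⟨(LinearMap.ker f).injective_subtype, fun x => by simp, hf⟩

variable {N : ModuleCat.{u} A} (hN : ∀ x : N, e • x = 0)

include hN in
theorem ext_zero_eq_zero_of_smul {X : Type u} [AddCommGroup X] [Module A X]
    (hX : ∀ x : X, e • x = x) (f : Ext.{u} (ModuleCat.of A X) N 0) : f = 0 := by
  obtain ⟨f, rfl⟩ := (Ext.mk₀_bijective _ _).2 f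
  refine (Ext.mk₀_eq_zero_iff _).mpr ?_
  ext x
  change f.hom x = 0
  rw [← hX x]
  exact (f.hom.map_smul e x).trans (hN _)

include hN in
/-- If `A e` is stable under multiplication by `e` on the left, then there are no extensions of
modules on which `e` acts as the identity by modules on which it acts as zero. -/
theorem ext_eq_zero_of_smul (he : ∀ a, e * a * e = a * e) {X : Type u} [AddCommGroup X] [Module A X]
    (hX : ∀ x : X, e • x = x) (n : ℕ) (f : Ext.{u} (ModuleCat.of A X) N n) : f = 0 := by
  have hee : e * e = e := by simpa using he 1
  induction n generalizing X with
  | zero => exact ext_zero_eq_zero_of_smul hN hX f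
  | succ n ih =>
    let p : (X →₀ leftIdeal e) →ₗ[A] X :=
      Finsupp.lsum ℕ fun x => LinearMap.toSpanSingleton A X x ∘ₗ (leftIdeal e).subtype
    have hp : Function.Surjective p := by
      intro x
      refine ⟨Finsupp.single x ⟨e, (mem_leftIdeal hee).mpr hee⟩, ?_⟩
      simp [p, hX]
    have := leftIdeal_finsupp_projective hee X
    obtain ⟨v, rfl⟩ := (isSES_ker hp).exists_extClass_comp f (ext_eq_zero_of_projective _)
    -- The kernel of the cover consists of families in `A e`, on which `e` acts as the identity by
    -- `he`, so the induction hypothesis applies to it.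
    rw [ih ?_ v, Ext.comp_zero]
    rintro ⟨y, hy⟩
    apply Subtype.ext
    change e • y = y
    ext x
    change e * (y x : A) = y x
    have h1 := (mem_leftIdeal hee).mp (y x).2
    rw [← h1, ← mul_assoc, he]

end Idempotents

/-! ### Idempotents of the category algebra and extensions between the `C(x, x)`. -/

section CategoryAlgebra

namespace CatAlgebra

variable {C : Type u} [Category.{u} C] [Preadditive C]

open Classical in
/-- The sum of the identities of the objects in `U`. -/
def idem (U : Set C) : CatAlgebra C := fun x y => if x ∈ U then (1 : CatAlgebra C) x y else 0

open Classical in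
/-- A morphism `x ⟶ y`, as an element of the associated algebra. -/
def single (x y : C) (f : x ⟶ y) : CatAlgebra C :=
  Pi.single (M := fun x : C => ∀ y : C, (x ⟶ y)) x (Pi.single y f)

@[simp] theorem single_same (x y : C) (f : x ⟶ y) : single x y f x y = f := by
  classical
  simp [single]

theorem single_ne_left {x x' : C} (h : x' ≠ x) (y y' : C) (f : x ⟶ y) :
    single x y f x' y' = 0 := by
  classical
  simp [single, h]

theorem single_ne_right {y y' : C} (h : y' ≠ y) (x x' : C) (f : x ⟶ y) :
    single x y f x' y' = 0 := by
  by_cases hx : x' = x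
  · subst hx
    simp [single, h]
  · exact single_ne_left hx _ _ _

theorem single_add (x y : C) (f g : x ⟶ y) : single x y (f + g) = single x y f + single x y g := by
  classical
  rw [single, Pi.single_add, Pi.single_add]
  rfl

theorem one_apply_self (x : C) : (1 : CatAlgebra C) x x = 𝟙 x := by
  simp [one_apply]

variable [Fintype C]

open Classical in
theorem idem_mul_apply (U : Set C) (a : CatAlgebra C) (x z : C) :
    (idem U * a) x z = if z ∈ U then a x z else 0 := by
  have h : ∀ y, idem U y z = if z ∈ U then (1 : CatAlgebra C) y z else 0 := by
    intro y
    by_cases hy : y = z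
    · rw [idem, hy]
    · simp [idem, one_apply, hy]
  rw [mul_apply]
  simp only [h]
  split_ifs with hz
  · rw [← mul_apply, one_mul]
  · simp

open Classical in
theorem mul_idem_apply (U : Set C) (a : CatAlgebra C) (x z : C) :
    (a * idem U) x z = if x ∈ U then a x z else 0 := by
  rw [mul_apply]
  by_cases hx : x ∈ U
  · simp only [idem, hx, if_true]
    rw [← mul_apply, mul_one]
  · simp [idem, hx]

theorem single_mul_idem (x : C) (f : x ⟶ x) : single x x f * idem {x} = single x x f := by
  ext y z
  rw [mul_idem_apply]
  split_ifs with h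
  · rfl
  · rw [single_ne_left h]

theorem mul_single_apply_self (x y : C) (a : CatAlgebra C) (f : x ⟶ x) :
    (a * single x x f) y y = single x x (f ≫ a x x) y y := by
  rw [mul_apply, Finset.sum_eq_single x]
  · by_cases h : y = x
    · subst h
      rw [single_same, single_same]
    · rw [single_ne_left h, single_ne_left h, Limits.zero_comp]
  · intro z _ hz
    rw [single_ne_right hz, Limits.zero_comp]
  · simp

end CatAlgebra

open CatAlgebra

variable (k : Type w) [Field k] {C : Type u} [Fintype C] [PartialOrder C] [Category.{u} C]
  [Preadditive C] [Linear k C] [IsDirectedCategory k C]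

-- The right factor selects sources in `U`, the left one targets in `U`; a nonzero morphism starting
-- in an upper set ends in it.
include k in
theorem idem_mul_mul_idem {U : Set C} (hU : IsUpperSet U) (a : CatAlgebra C) :
    idem U * a * idem U = a * idem U := by
  ext x z
  simp only [mul_idem_apply, idem_mul_apply]
  split_ifs with hx hz
  · rfl
  · by_contra h
    exact hz (hU (IsDirectedCategory.le_of_hom_ne_zero (k := k) (a x z) (Ne.symm h)) hx)
  · rfl

theorem idem_smul_endModule_of_mem {U : Set C} {x : C} (hx : x ∈ U) (m : endModule k C x) :
    idem U • m = m := by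
  change (m : x ⟶ x) ≫ idem U x x = m
  rw [idem, if_pos hx, one_apply_self]
  exact Category.comp_id _

theorem idem_smul_endModule_of_notMem {U : Set C} {x : C} (hx : x ∉ U) (m : endModule k C x) :
    idem U • m = 0 := by
  change (m : x ⟶ x) ≫ idem U x x = 0
  rw [idem, if_neg hx]
  exact Limits.comp_zero

open Abelian

/-- The idempotent of the objects above `x` is the identity on `C(x, x)` and zero on `C(y, y)`. -/
theorem ext_endModule_eq_zero_of_not_le {x y : C} (h : ¬ x ≤ y) {n : ℕ}
    (f : Ext.{u} (endModule k C x) (endModule k C y) n) : f = 0 :=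
  ext_eq_zero_of_smul (e := idem (Set.Ici x))
    (idem_smul_endModule_of_notMem k h) (idem_mul_mul_idem k (isUpperSet_Ici x))
    (X := endModule k C x) (idem_smul_endModule_of_mem k (Set.self_mem_Ici)) n f

theorem ext_zero_endModule_eq_zero {x y : C} (h : x ≠ y)
    (f : Ext.{u} (endModule k C x) (endModule k C y) 0) : f = 0 :=
  ext_zero_eq_zero_of_smul (e := idem {x})
    (idem_smul_endModule_of_notMem k (Ne.symm h))
    (X := endModule k C x) (idem_smul_endModule_of_mem k rfl) f

/-- The action on the identity of `x`, as a map of modules. -/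
def toEndModule (x : C) : CatAlgebra C →ₗ[CatAlgebra C] endModule k C x where
  toFun a := a x x
  map_add' _ _ := rfl
  map_smul' a b := (evalEnd k C x).map_mul a b

/-- The kernel of the projective cover map from `A e_x` to `C(x, x)` is supported strictly above
`x`, so it has no homomorphisms or extensions to `C(x, x)`; shift dimension. -/
theorem ext_succ_endModule_self_eq_zero (x : C) {n : ℕ}
    (f : Ext.{u} (endModule k C x) (endModule k C x) (n + 1)) : f = 0 := by
  have hee : idem {x} * idem {x} = idem {x} := by
    ext y z
    rw [mul_idem_apply, idem]
    split_ifs <;> rfl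
  let p : leftIdeal (idem {x}) →ₗ[CatAlgebra C] endModule k C x :=
    toEndModule k x ∘ₗ Submodule.subtype _
  have hp : Function.Surjective p := by
    intro m
    refine ⟨⟨single x x m, (mem_leftIdeal hee).mpr (single_mul_idem x m)⟩,
      single_same x x m⟩
  have := leftIdeal_projective hee
  obtain ⟨v, rfl⟩ := (isSES_ker hp).exists_extClass_comp f (ext_eq_zero_of_projective _)
  rw [ext_eq_zero_of_smul (e := idem (Set.Ioi x))
    (idem_smul_endModule_of_notMem k (lt_irrefl x)) (idem_mul_mul_idem k (isUpperSet_Ioi x))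
    (X := LinearMap.ker p) ?_ n v, Ext.comp_zero]
  rintro ⟨⟨a, ha⟩, h⟩
  apply Subtype.ext
  apply Subtype.ext
  change idem (Set.Ioi x) * a = a
  rw [mem_leftIdeal hee] at ha
  ext y z
  rw [idem_mul_apply]
  split_ifs with hz
  · rfl
  · by_contra h0
    have hyx : y = x := by
      by_contra hyx
      refine h0 (Eq.symm ?_)
      rw [← ha, mul_idem_apply]
      exact if_neg hyx
    subst hyx
    refine hz (lt_of_le_of_ne (IsDirectedCategory.le_of_hom_ne_zero (k := k) (a y z)
      (Ne.symm h0)) ?_)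
    rintro rfl
    exact h0 h.symm

end CategoryAlgebra

/-! ### The ideal `J` of a graded directed category and the splitting of `A / J`. -/

section GradedCategories

variable {k : Type w} [Field k] {C : Type u} [Fintype C] [PartialOrder C] [Category.{u} C]
  [Preadditive C] [Linear k C] [GradedCategory k C] [IsGradedDirectedCategory k C]

open CatAlgebra

omit [Fintype C] in
theorem deg_self_eq_bot (x : C) {n : ℕ} (hn : n ≠ 0) : GradedCategory.deg (k := k) x x n = ⊥ := by
  have h := (GradedCategory.isInternal (k := k) x x).submodule_iSupIndep.pairwiseDisjoint hn.symm
  rw [Function.onFun, IsGradedDirectedCategory.deg_zero_end] at h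
  exact disjoint_top.mp h.symm

theorem grading_apply_self (a : CatAlgebra C) (x : C) :
    (DirectSum.decompose (grading k C) a 0 : CatAlgebra C) x x = a x x := by
  induction a using DirectSum.Decomposition.inductionOn (grading k C) with
  | zero => rw [DirectSum.decompose_zero]; rfl
  | add a b ha hb =>
    rw [DirectSum.decompose_add, DirectSum.add_apply, Submodule.coe_add, CatAlgebra.add_apply, ha,
      hb, CatAlgebra.add_apply]
  | homogeneous a =>
    rename_i n
    by_cases hn : n = 0
    · subst hn
      rw [DirectSum.decompose_of_mem_same _ a.2]
    · rw [DirectSum.decompose_of_mem_ne _ a.2 hn]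
      have := a.2 x x
      rw [deg_self_eq_bot x hn, Submodule.mem_bot] at this
      rw [this, CatAlgebra.zero_apply]

theorem mem_positiveIdeal_grading {a : CatAlgebra C} :
    a ∈ positiveIdeal (grading k C) ↔ ∀ x, a x x = 0 := by
  rw [mem_positiveIdeal]
  constructor
  · intro h x
    rw [← grading_apply_self (k := k) a x, h, CatAlgebra.zero_apply]
  · intro h
    ext x y
    by_cases hxy : x = y
    · subst hxy
      rw [grading_apply_self, h, CatAlgebra.zero_apply]
    · have := (DirectSum.decompose (grading k C) a 0).2 x y
      rwa [IsGradedDirectedCategory.deg_zero_ne x y hxy, Submodule.mem_bot] at this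

/-- The diagonal of `a` vanishes, so `a` only has components going strictly up. Writing `a` as `a *
a`, components with target `z` are expressed by components with smaller target, and induction on `z`
kills them. -/
theorem eq_zero_of_mul_self_eq {a : CatAlgebra C} (ha : a ∈ positiveIdeal (grading k C))
    (h : a * a = a) : a = 0 := by
  rw [mem_positiveIdeal_grading] at ha
  have key : ∀ z x : C, a x z = 0 := by
    intro z
    induction z using WellFoundedLT.induction with
    | ind z ih =>
      intro x
      rw [← h, mul_apply]
      refine Finset.sum_eq_zero fun y _ => ?_
      by_cases hyz : a y z = 0
      · rw [hyz, Limits.comp_zero]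
      · have hle := IsDirectedCategory.le_of_hom_ne_zero (k := k) _ hyz
        have hne : y ≠ z := by
          rintro rfl
          exact hyz (ha y)
        rw [ih y (lt_of_le_of_ne hle hne), Limits.zero_comp]
  ext x z
  exact key z x

theorem isKilled_endModule (x : C) : IsKilled (positiveIdeal (grading k C)) (endModule k C x) := by
  intro a ha m
  change (m : x ⟶ x) ≫ a x x = 0
  rw [mem_positiveIdeal_grading.mp ha]
  exact Limits.comp_zero

variable (k) in
/-- The projection `A / J → C(x, x)`. -/
def quotToEnd (x : C) :
    (CatAlgebra C ⧸ positiveIdeal (grading k C)) →ₗ[CatAlgebra C] endModule k C x :=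
  Submodule.liftQ _ (toEndModule k x) fun _ ha => mem_positiveIdeal_grading.mp ha x

variable (k) in
/-- The inclusion `C(x, x) → A / J`. -/
def endToQuot (x : C) :
    endModule k C x →ₗ[CatAlgebra C] (CatAlgebra C ⧸ positiveIdeal (grading k C)) where
  toFun m := Submodule.Quotient.mk (single x x m)
  map_add' m m' := congrArg Submodule.Quotient.mk (single_add x x m m')
  map_smul' a m := by
    refine (Submodule.Quotient.eq _).mpr (mem_positiveIdeal_grading.mpr fun y => ?_)
    change single x x ((m : x ⟶ x) ≫ a x x) y y - (a * single x x m) y y = 0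
    exact sub_eq_zero.mpr (mul_single_apply_self x y a m).symm

theorem quotToEnd_comp_endToQuot (x : C) : quotToEnd k x ∘ₗ endToQuot k x = LinearMap.id := by
  ext m
  exact single_same x x m

theorem sum_endToQuot_comp_quotToEnd : ∑ x : C, endToQuot k x ∘ₗ quotToEnd k x = LinearMap.id := by
  refine LinearMap.ext fun a => ?_
  obtain ⟨a, rfl⟩ := Submodule.Quotient.mk_surjective _ a
  have h : ∀ x, (endToQuot k x ∘ₗ quotToEnd k x)
      (Submodule.Quotient.mk a) = Submodule.mkQ (positiveIdeal (grading k C)) (single x x (a x x)) :=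
    fun x => rfl
  rw [LinearMap.sum_apply, Finset.sum_congr rfl fun x _ => h x, ← map_sum, Submodule.mkQ_apply,
    LinearMap.id_apply, Submodule.Quotient.eq, mem_positiveIdeal_grading]
  intro y
  let ev : CatAlgebra C →+ (y ⟶ y) := (evalEnd k C y).toAddMonoidHom
  change ev (_ - _) = 0
  rw [map_sub, map_sum, Finset.sum_eq_single y, sub_eq_zero]
  · exact single_same y y (a y y)
  · intro x _ hx
    exact single_ne_left (Ne.symm hx) _ _ _
  · simp

end GradedCategories

/-! ### The graded modules `Ext*(X, ⨁ C(y, y))` over the Yoneda algebra. -/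

section YonedaModules

open Abelian

variable (k : Type w) [Field k] (C : Type u) [Fintype C] [PartialOrder C] [Category.{u} C]
  [Preadditive C] [Linear k C] [IsDirectedCategory k C]

/-- The algebra of the Yoneda category. -/
abbrev YonedaAlgebra : Type u := CatAlgebra (YonedaCategory k C)

variable {k C} in
/-- A component of an element of the algebra of the Yoneda category. -/
def YonedaAlgebra.app (e : YonedaAlgebra k C) (x y : C) : YonedaHom k C x y := e x y

namespace YonedaAlgebra

variable {k C} in
@[ext]
theorem ext {a b : YonedaAlgebra k C} (h : ∀ x y, a.app x y = b.app x y) : a = b :=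
  CatAlgebra.ext h

/-- An element of the algebra of the Yoneda category, from its components. -/
def mk (f : ∀ x y : C, YonedaHom k C x y) : YonedaAlgebra k C := f

variable {k C}

@[simp] theorem app_add (a b : YonedaAlgebra k C) (x y : C) :
    (a + b).app x y = a.app x y + b.app x y := rfl

@[simp] theorem app_zero (x y : C) : (0 : YonedaAlgebra k C).app x y = 0 := rfl

@[simp] theorem app_smul (c : k) (a : YonedaAlgebra k C) (x y : C) :
    (c • a).app x y = c • a.app x y := rfl

theorem app_mul (b a : YonedaAlgebra k C) (x z : C) :
    (b * a).app x z = ∑ y, yonedaComp k C x y z (a.app x y) (b.app y z) := rfl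

theorem app_one_self (x : C) : (1 : YonedaAlgebra k C).app x x = yonedaId k C x :=
  CatAlgebra.one_apply_self (C := YonedaCategory k C) x

theorem app_one_ne {x y : C} (h : x ≠ y) : (1 : YonedaAlgebra k C).app x y = 0 :=
  dif_neg h

theorem mem_grading {n : ℕ} {a : YonedaAlgebra k C} :
    a ∈ CatAlgebra.grading k (YonedaCategory k C) n ↔
      ∀ x y, a.app x y ∈ LinearMap.range (DirectSum.lof k ℕ
        (fun i => Ext.{u} (endModule k C x) (endModule k C y) i) n) := Iff.rfl

end YonedaAlgebra

variable (X : ModuleCat.{u} (CatAlgebra C))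

/-- The space `⨁ₙ Extⁿ(X, C(y, y))`. -/
abbrev ExtHom (y : C) : Type u := DirectSum ℕ fun n => Ext.{u} X (endModule k C y) n

/-- The Yoneda product. -/
def extComp (y z : C) : ExtHom k C X y →ₗ[k] YonedaHom k C y z →ₗ[k] ExtHom k C X z :=
  DirectSum.toModule k ℕ _ fun m => LinearMap.flip <|
    DirectSum.toModule k ℕ _ fun n => LinearMap.flip <|
      (Ext.bilinearCompOfLinear k X (endModule k C y) (endModule k C z)
        m n (m + n) rfl).compr₂
        (DirectSum.lof k ℕ (fun i => Ext.{u} X (endModule k C z) i) (m + n))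

variable {X}

theorem extComp_lof {y z : C} {m n p : ℕ} (h : m + n = p) (f : Ext.{u} X (endModule k C y) m)
    (g : Ext.{u} (endModule k C y) (endModule k C z) n) :
    extComp k C X y z (DirectSum.lof k ℕ _ m f) (DirectSum.lof k ℕ _ n g) =
      DirectSum.lof k ℕ _ p (f.comp g h) := by
  subst h
  simp [extComp]

variable {k C}

theorem extHom_induction {y : C} {p : ExtHom k C X y → Prop} (f : ExtHom k C X y)
    (zero : p 0) (lof : ∀ n (f : Ext.{u} X (endModule k C y) n), p (DirectSum.lof k ℕ _ n f))
    (add : ∀ f g, p f → p g → p (f + g)) : p f :=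
  DirectSum.induction_on f zero lof add

theorem extComp_id {y : C} (f : ExtHom k C X y) :
    extComp k C X y y f (yonedaId k C y) = f := by
  induction f using extHom_induction with
  | zero => exact LinearMap.map_zero₂ _ _
  | lof n f => rw [yonedaId, extComp_lof k C (add_zero n), Ext.comp_mk₀_id]
  | add f g hf hg => rw [LinearMap.map_add₂, hf, hg]

theorem extComp_assoc {y z t : C} (f : ExtHom k C X y) (g : YonedaHom k C y z)
    (h : YonedaHom k C z t) :
    extComp k C X z t (extComp k C X y z f g) h =
      extComp k C X y t f (yonedaComp k C y z t g h) := by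
  induction f using extHom_induction with
  | zero => simp only [LinearMap.map_zero₂]
  | add f f' hf hf' => simp only [LinearMap.map_add₂, hf, hf']
  | lof l f =>
    induction g using yonedaHom_induction with
    | zero => simp only [LinearMap.zero_apply, map_zero]
    | add g g' hg hg' => simp only [LinearMap.add_apply, map_add, hg, hg']
    | lof m g =>
      induction h using yonedaHom_induction with
      | zero => simp only [map_zero]
      | add h h' hh hh' => simp only [map_add, hh, hh']
      | lof n h =>
        rw [extComp_lof k C rfl, extComp_lof k C rfl, yonedaComp_lof k C rfl,
          extComp_lof k C (add_assoc l m n).symm, Ext.comp_assoc f g h rfl rfl rfl]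

variable (k C) in
/-- The Yoneda product with a class in `Extᵈ(X, Y)` on the left. -/
def extPre {X Y : ModuleCat.{u} (CatAlgebra C)} {d : ℕ} (α : Ext.{u} X Y d) (y : C) :
    ExtHom k C Y y →ₗ[k] ExtHom k C X y :=
  DirectSum.toModule k ℕ _ fun n =>
    DirectSum.lof k ℕ (fun i => Ext.{u} X (endModule k C y) i) (d + n) ∘ₗ
      Ext.bilinearCompOfLinear k X Y (endModule k C y) d n (d + n) rfl α

section Pre

variable {X Y Z : ModuleCat.{u} (CatAlgebra C)} {d d' : ℕ}

theorem extPre_lof (α : Ext.{u} X Y d) {y : C} {n p : ℕ} (h : d + n = p)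
    (f : Ext.{u} Y (endModule k C y) n) :
    extPre k C α y (DirectSum.lof k ℕ _ n f) = DirectSum.lof k ℕ _ p (α.comp f h) := by
  subst h
  simp [extPre]

theorem extPre_extComp (α : Ext.{u} X Y d) {y z : C} (f : ExtHom k C Y y) (g : YonedaHom k C y z) :
    extPre k C α z (extComp k C Y y z f g) = extComp k C X y z (extPre k C α y f) g := by
  induction f using extHom_induction with
  | zero => simp only [map_zero, LinearMap.zero_apply]
  | add f f' hf hf' => simp only [map_add, LinearMap.add_apply, hf, hf']
  | lof m f =>
    induction g using yonedaHom_induction with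
    | zero => simp only [map_zero]
    | add g g' hg hg' => simp only [map_add, hg, hg']
    | lof n g =>
      rw [extComp_lof k C rfl, extPre_lof α rfl, extPre_lof α rfl,
        extComp_lof k C (add_assoc d m n), Ext.comp_assoc α f g rfl rfl (add_assoc d m n)]

theorem extPre_extPre (α : Ext.{u} X Y d) (β : Ext.{u} Y Z d') {p : ℕ} (h : d + d' = p) {y : C}
    (f : ExtHom k C Z y) : extPre k C α y (extPre k C β y f) = extPre k C (α.comp β h) y f := by
  induction f using extHom_induction with
  | zero => simp only [map_zero]
  | add f f' hf hf' => simp only [map_add, hf, hf']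
  | lof m f =>
    subst h
    rw [extPre_lof β rfl, extPre_lof α (add_assoc d d' m).symm, extPre_lof (α.comp β rfl) rfl,
      Ext.comp_assoc α β f rfl rfl rfl]

theorem extPre_add (α β : Ext.{u} X Y d) {y : C} (f : ExtHom k C Y y) :
    extPre k C (α + β) y f = extPre k C α y f + extPre k C β y f := by
  induction f using extHom_induction with
  | zero => simp only [map_zero, add_zero]
  | add f f' hf hf' => simp only [map_add, hf, hf', add_add_add_comm]
  | lof m f => rw [extPre_lof _ rfl, extPre_lof _ rfl, extPre_lof _ rfl, Ext.add_comp, map_add]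

theorem extPre_zero {y : C} (f : ExtHom k C Y y) : extPre k C (0 : Ext.{u} X Y d) y f = 0 := by
  have := extPre_add (0 : Ext.{u} X Y d) 0 f
  rw [add_zero] at this
  simpa using this

theorem extPre_sum {ι : Type*} (s : Finset ι) (α : ι → Ext.{u} X Y d) {y : C} (f : ExtHom k C Y y) :
    extPre k C (∑ i ∈ s, α i) y f = ∑ i ∈ s, extPre k C (α i) y f := by
  classical
  induction s using Finset.induction_on with
  | empty => simp [extPre_zero]
  | insert i s hi ih => rw [Finset.sum_insert hi, Finset.sum_insert hi, extPre_add, ih]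

theorem extPre_id {y : C} (f : ExtHom k C X y) : extPre k C (Ext.mk₀ (𝟙 X)) y f = f := by
  induction f using extHom_induction with
  | zero => simp only [map_zero]
  | add f f' hf hf' => simp only [map_add, hf, hf']
  | lof m f => rw [extPre_lof _ (zero_add m), Ext.mk₀_id_comp]

end Pre

variable (k C) in
/-- The left module `⨁_y ⨁ₙ Extⁿ(X, C(y, y))` over the algebra of the Yoneda category. -/
def ExtModule (X : ModuleCat.{u} (CatAlgebra C)) : Type u := ∀ y : C, ExtHom k C X y

namespace ExtModule

@[ext]
theorem ext {f g : ExtModule k C X} (h : ∀ y, f y = g y) : f = g := funext h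

instance : AddCommGroup (ExtModule k C X) := inferInstanceAs (AddCommGroup (∀ y, ExtHom k C X y))
instance : Module k (ExtModule k C X) := inferInstanceAs (Module k (∀ y, ExtHom k C X y))

@[simp] theorem add_apply (f g : ExtModule k C X) (y : C) : (f + g) y = f y + g y := rfl
@[simp] theorem zero_apply (y : C) : (0 : ExtModule k C X) y = 0 := rfl
@[simp] theorem smul_apply (c : k) (f : ExtModule k C X) (y : C) : (c • f) y = c • f y := rfl

theorem sum_apply {ι : Type*} (s : Finset ι) (f : ι → ExtModule k C X) (y : C) :
    (∑ i ∈ s, f i) y = ∑ i ∈ s, f i y := Finset.sum_apply y s f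

instance : SMul (YonedaAlgebra k C) (ExtModule k C X) where
  smul e f z := ∑ y, extComp k C X y z (f y) (e.app y z)

theorem algebra_smul_apply (e : YonedaAlgebra k C) (f : ExtModule k C X) (z : C) :
    (e • f) z = ∑ y, extComp k C X y z (f y) (e.app y z) := rfl

instance : Module (YonedaAlgebra k C) (ExtModule k C X) where
  one_smul f := by
    ext1 z
    rw [algebra_smul_apply, Finset.sum_eq_single z, YonedaAlgebra.app_one_self, extComp_id]
    · intro y _ hy
      rw [YonedaAlgebra.app_one_ne hy, map_zero]
    · simp
  mul_smul a b f := by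
    ext1 t
    simp only [algebra_smul_apply, YonedaAlgebra.app_mul, map_sum, LinearMap.sum_apply,
      extComp_assoc]
    exact Finset.sum_comm
  smul_zero a := by ext1 z; simp [algebra_smul_apply]
  smul_add a f g := by ext1 z; simp [algebra_smul_apply, Finset.sum_add_distrib]
  add_smul a b f := by ext1 z; simp [algebra_smul_apply, Finset.sum_add_distrib]
  zero_smul f := by ext1 z; simp [algebra_smul_apply]

instance : IsScalarTower k (YonedaAlgebra k C) (ExtModule k C X) where
  smul_assoc c a f := by ext1 z; simp [algebra_smul_apply, Finset.smul_sum]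

variable (k) in
/-- Precomposition with a class in `Extᵈ(X, Y)`. -/
def pre {X Y : ModuleCat.{u} (CatAlgebra C)} {d : ℕ} (α : Ext.{u} X Y d) :
    ExtModule k C Y →ₗ[YonedaAlgebra k C] ExtModule k C X where
  toFun f y := extPre k C α y (f y)
  map_add' f g := funext fun y => map_add (extPre k C α y) (f y) (g y)
  map_smul' e f := by
    ext1 z
    change extPre k C α z ((e • f) z) = ∑ y, extComp k C X y z (extPre k C α y (f y)) (e.app y z)
    rw [algebra_smul_apply, map_sum]
    exact Finset.sum_congr rfl fun y _ => extPre_extComp α _ _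

theorem pre_apply {X Y : ModuleCat.{u} (CatAlgebra C)} {d : ℕ} (α : Ext.{u} X Y d)
    (f : ExtModule k C Y) (y : C) : pre k α f y = extPre k C α y (f y) := rfl

variable (k C X) in
/-- The elements of `ExtModule k C X` which are homogeneous of degree `n`. -/
def homogeneous (n : ℕ) : Submodule k (ExtModule k C X) where
  carrier := {f | ∀ y, f y ∈ LinearMap.range (DirectSum.lof k ℕ
    (fun i => Ext.{u} X (endModule k C y) i) n)}
  add_mem' hf hg y := add_mem (hf y) (hg y)
  zero_mem' _ := zero_mem _
  smul_mem' c _ hf y := Submodule.smul_mem _ c (hf y)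

theorem smul_mem_homogeneous {m n : ℕ} {a : YonedaAlgebra k C} {f : ExtModule k C X}
    (ha : a ∈ CatAlgebra.grading k (YonedaCategory k C) m) (hf : f ∈ homogeneous k C X n) :
    a • f ∈ homogeneous k C X (m + n) := by
  intro z
  rw [algebra_smul_apply]
  refine Submodule.sum_mem _ fun y _ => ?_
  obtain ⟨g, hg⟩ := hf y
  obtain ⟨b, hb⟩ := YonedaAlgebra.mem_grading.mp ha y z
  rw [← hg, ← hb, extComp_lof k C (add_comm n m)]
  exact ⟨_, rfl⟩

theorem pre_mem_homogeneous {X Y : ModuleCat.{u} (CatAlgebra C)} {d n : ℕ} (α : Ext.{u} X Y d)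
    {f : ExtModule k C Y} (hf : f ∈ homogeneous k C Y n) :
    pre k α f ∈ homogeneous k C X (d + n) := by
  intro y
  obtain ⟨g, hg⟩ := hf y
  rw [pre_apply, ← hg, extPre_lof α rfl]
  exact ⟨_, rfl⟩

variable (k C X) in
/-- The grading of `ExtModule k C X`, with the part `Extⁿ` placed in degree `n + s`. -/
def shiftedDeg (s j : ℤ) : Submodule k (ExtModule k C X) where
  carrier := {f | ∀ y (n : ℕ), n + s ≠ j → f y n = 0}
  add_mem' hf hg y n h := by rw [add_apply, DirectSum.add_apply, hf y n h, hg y n h, add_zero]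
  zero_mem' _ _ _ := rfl
  smul_mem' c f hf y n h := by rw [smul_apply, DirectSum.smul_apply, hf y n h, smul_zero]

theorem eq_lof_of_forall_ne {y : C} {v : ExtHom k C X y} {n : ℕ} (h : ∀ m, m ≠ n → v m = 0) :
    v = DirectSum.lof k ℕ (fun i => Ext.{u} X (endModule k C y) i) n (v n) := by
  ext m : 1
  by_cases hm : m = n
  · subst hm
    rw [DirectSum.lof_apply]
  · rw [h m hm, DirectSum.lof_eq_of, DirectSum.of_eq_of_ne _ _ _ hm]

theorem mem_shiftedDeg_add {s : ℤ} {n : ℕ} {f : ExtModule k C X} :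
    f ∈ shiftedDeg k C X s (n + s) ↔ f ∈ homogeneous k C X n := by
  constructor
  · intro h y
    exact ⟨f y n, (eq_lof_of_forall_ne fun m hm => h y m (by omega)).symm⟩
  · intro h y m hm
    obtain ⟨g, hg⟩ := h y
    rw [← hg, DirectSum.lof_eq_of, DirectSum.of_eq_of_ne]
    omega

theorem eq_zero_of_mem_shiftedDeg_of_lt {s j : ℤ} (h : j < s) {f : ExtModule k C X}
    (hf : f ∈ shiftedDeg k C X s j) : f = 0 := by
  ext y n
  exact hf y n (by omega)

theorem shiftedDeg_isInternal (s : ℤ) : DirectSum.IsInternal (shiftedDeg k C X s) := by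
  classical
  rw [DirectSum.isInternal_submodule_iff_iSupIndep_and_iSup_eq_top]
  constructor
  · intro j
    -- All other components lie in the submodule of families vanishing in degree `j`, which meets
    -- the component `j` trivially.
    have hle : (⨆ (j') (_ : j' ≠ j), shiftedDeg k C X s j') ≤
        ({ carrier := {f | ∀ y (n : ℕ), n + s = j → f y n = 0}
           add_mem' := fun hf hg y n h => by
            rw [add_apply, DirectSum.add_apply, hf y n h, hg y n h, add_zero]
           zero_mem' := fun _ _ _ => rfl
           smul_mem' := fun c f hf y n h => by
            rw [smul_apply, DirectSum.smul_apply, hf y n h, smul_zero] } :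
          Submodule k (ExtModule k C X)) :=
      iSup₂_le fun j' hj f hf y n h => hf y n (by omega)
    refine Disjoint.mono_right hle (Submodule.disjoint_def.mpr fun f hf hf' => ?_)
    ext y n
    by_cases h : n + s = j
    · exact hf' y n h
    · exact hf y n h
  · rw [eq_top_iff]
    intro f _
    have hf : f = ∑ y, (Pi.single (M := fun y => ExtHom k C X y) y (f y) : ExtModule k C X) :=
      (Finset.univ_sum_single (M := fun y => ExtHom k C X y) f).symm
    rw [hf]
    refine Submodule.sum_mem _ fun y _ => ?_
    induction f y using extHom_induction with
    | zero => rw [Pi.single_zero]; exact zero_mem _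
    | add f g hf hg => rw [Pi.single_add]; exact add_mem hf hg
    | lof n g =>
      refine Submodule.mem_iSup_of_mem (n + s) (mem_shiftedDeg_add.mpr fun z => ?_)
      by_cases h : z = y
      · subst h
        rw [Pi.single_eq_same]
        exact ⟨g, rfl⟩
      · rw [Pi.single_eq_of_ne h]
        exact zero_mem _

variable (k C X) in
/-- `ExtModule k C X` as a graded module, with the part `Extⁿ` placed in degree `n + s`. -/
def graded (s : ℤ) : GrModule (CatAlgebra.grading k (YonedaCategory k C)) where
  carrier := ExtModule k C X
  deg := shiftedDeg k C X s
  isInternal := shiftedDeg_isInternal s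
  smul_mem {i j a f} ha hf := by
    by_cases h : j < s
    · rw [eq_zero_of_mem_shiftedDeg_of_lt h hf, smul_zero]
      exact zero_mem _
    · obtain ⟨n, rfl⟩ : ∃ n : ℕ, j = n + s := ⟨(j - s).toNat, by omega⟩
      have := smul_mem_homogeneous ha (mem_shiftedDeg_add.mp hf)
      rw [← mem_shiftedDeg_add (s := s)] at this
      rwa [Nat.cast_add, add_assoc] at this

end ExtModule

end YonedaModules

/-! ### Precomposition componentwise, and on summands of finite powers. -/

section YonedaComponents

open Abelian

variable {k : Type w} [Field k] {C : Type u} [Fintype C] [PartialOrder C] [Category.{u} C]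
  [Preadditive C] [Linear k C] [IsDirectedCategory k C] {X Y : ModuleCat.{u} (CatAlgebra C)}

theorem extPre_apply_add {d : ℕ} (α : Ext.{u} X Y d) {y : C} (v : ExtHom k C Y y) {n m : ℕ}
    (h : d + n = m) : extPre k C α y v m = α.comp (v n) h := by
  subst h
  induction v using extHom_induction with
  | zero => rw [map_zero, DirectSum.zero_apply, DirectSum.zero_apply, Ext.comp_zero]
  | add v v' hv hv' =>
    rw [map_add, DirectSum.add_apply, DirectSum.add_apply, Ext.comp_add, hv, hv']
  | lof l f =>
    rw [extPre_lof α rfl]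
    by_cases hl : l = n
    · subst hl
      rw [DirectSum.lof_apply, DirectSum.lof_apply]
    · rw [DirectSum.lof_eq_of, DirectSum.lof_eq_of, DirectSum.of_eq_of_ne _ _ _ (by omega),
        DirectSum.of_eq_of_ne _ _ _ (by omega), Ext.comp_zero]

theorem extPre_apply_of_lt {d : ℕ} (α : Ext.{u} X Y d) {y : C} (v : ExtHom k C Y y) {n : ℕ}
    (h : n < d) : extPre k C α y v n = 0 := by
  induction v using extHom_induction with
  | zero => rw [map_zero, DirectSum.zero_apply]
  | add v v' hv hv' => rw [map_add, DirectSum.add_apply, hv, hv', add_zero]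
  | lof l f =>
    rw [extPre_lof α rfl, DirectSum.lof_eq_of, DirectSum.of_eq_of_ne]
    omega

/-- A homogeneous map of degree one which is surjective in every degree is surjective. -/
theorem ExtModule.exists_pre_eq (α : Ext.{u} X Y 1) (f : ExtModule k C X) (h0 : ∀ y, f y 0 = 0)
    (h : ∀ y n, ∃ g, α.comp g (add_comm 1 n) = f y (n + 1)) :
    ∃ g : ExtModule k C Y, ExtModule.pre k α g = f := by
  classical
  choose g hg using h
  -- By `h0` the support does not contain zero, so `n - 1` is a genuine predecessor.
  refine ⟨fun y => ∑ n ∈ (f y).support, DirectSum.lof k ℕ _ (n - 1) (g y (n - 1)), ?_⟩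
  ext1 y
  change extPre k C α y _ = _
  rw [map_sum]
  conv_rhs => rw [← DirectSum.sum_support_of (f y)]
  refine Finset.sum_congr rfl fun n hn => ?_
  have hn0 : n ≠ 0 := by
    rintro rfl
    exact DFinsupp.mem_support_iff.mp hn (h0 y)
  obtain ⟨n, rfl⟩ := Nat.exists_eq_succ_of_ne_zero hn0
  rw [extPre_lof α (add_comm 1 _)]
  exact congrArg _ (hg y n)

theorem extComp_mk₀ (φ : X ⟶ endModule k C x) {y : C} (g : YonedaHom k C x y) :
    extComp k C X x y (DirectSum.lof k ℕ _ 0 (Ext.mk₀ φ)) g = extPre k C (Ext.mk₀ φ) y g := by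
  induction g using yonedaHom_induction with
  | zero => simp only [map_zero]
  | add g g' hg hg' => simp only [map_add, hg, hg']
  | lof n g => rw [extComp_lof k C (zero_add n), extPre_lof _ (zero_add n)]

theorem pre_mk₀_sum {r : ℕ} (f : Fin r → (X ⟶ Y)) (m : ExtModule k C Y) :
    ∑ j, ExtModule.pre k (Ext.mk₀ (f j)) m = ExtModule.pre k (Ext.mk₀ (∑ j, f j)) m := by
  ext1 y
  rw [Ext.mk₀_sum, ExtModule.sum_apply]
  exact (extPre_sum _ _ _).symm

theorem sum_pre_pre {X Y : Type u} [AddCommGroup X] [Module (CatAlgebra C) X] [AddCommGroup Y]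
    [Module (CatAlgebra C) Y] {r : ℕ} {s : Fin r → X →ₗ[CatAlgebra C] Y}
    {p : Fin r → Y →ₗ[CatAlgebra C] X} (h : ∑ j, p j ∘ₗ s j = LinearMap.id)
    (m : ExtModule k C (ModuleCat.of _ X)) :
    ∑ j, ExtModule.pre k (Ext.mk₀ (ModuleCat.ofHom (s j)))
      (ExtModule.pre k (Ext.mk₀ (ModuleCat.ofHom (p j))) m) = m := by
  have h1 : ∀ j, ExtModule.pre k (Ext.mk₀ (ModuleCat.ofHom (s j)))
      (ExtModule.pre k (Ext.mk₀ (ModuleCat.ofHom (p j))) m) =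
      ExtModule.pre k (Ext.mk₀ (ModuleCat.ofHom (p j ∘ₗ s j))) m := by
    intro j
    ext1 y
    refine (extPre_extPre _ _ (zero_add 0) _).trans ?_
    rw [Ext.mk₀_comp_mk₀]
    rfl
  rw [Finset.sum_congr rfl fun j _ => h1 j, pre_mk₀_sum]
  have h2 : ∑ j, ModuleCat.ofHom (p j ∘ₗ s j) = 𝟙 (ModuleCat.of (CatAlgebra C) X) := by
    ext x
    have := LinearMap.congr_fun h x
    simpa using this
  rw [h2]
  ext1 y
  exact extPre_id _

/-- `Ext` is additive and contravariant, so the decomposition of the identity carries over with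
inclusions and projections exchanged. -/
theorem InAdd.extModule {X Y : Type u} [AddCommGroup X] [Module (CatAlgebra C) X] [AddCommGroup Y]
    [Module (CatAlgebra C) Y] (h : InAdd (A := CatAlgebra C) Y X) :
    InAdd (A := YonedaAlgebra k C) (ExtModule k C (ModuleCat.of _ Y))
      (ExtModule k C (ModuleCat.of _ X)) := by
  obtain ⟨r, s, p, h⟩ := h
  refine ⟨r, fun j => ExtModule.pre k (Ext.mk₀ (ModuleCat.ofHom (p j))),
    fun j => ExtModule.pre k (Ext.mk₀ (ModuleCat.ofHom (s j))), ?_⟩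
  ext1 m
  rw [LinearMap.sum_apply]
  exact sum_pre_pre h m

theorem InAdd.projective {R M : Type u} [Ring R] [AddCommGroup M] [Module R M]
    (h : InAdd (A := R) R M) : Module.Projective R M := by
  obtain ⟨r, s, p, h⟩ := h
  refine .of_split (LinearMap.pi s) (∑ j, p j ∘ₗ LinearMap.proj j) ?_
  ext m
  have := LinearMap.congr_fun h m
  simpa using this

end YonedaComponents

/-! ### The `Ext` module of `A₀` as the regular module over `E`. -/

section RegularModule

open Abelian CatAlgebra

variable (k : Type w) [Field k] (C : Type u) [Fintype C] [PartialOrder C] [Category.{u} C]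
  [Preadditive C] [Linear k C] [GradedCategory k C] [IsGradedDirectedCategory k C]

/-- The module `A₀ = A / J`. -/
abbrev degZero : ModuleCat.{u} (CatAlgebra C) :=
  ModuleCat.of (CatAlgebra C) (CatAlgebra C ⧸ positiveIdeal (grading k C))

variable {C}

/-- The inclusion `C(x, x) → A₀`. -/
def inclEnd (x : C) : endModule k C x ⟶ degZero k C :=
  (ModuleCat.ofHom (endToQuot k x) :)

/-- The projection `A₀ → C(x, x)`. -/
def projEnd (x : C) : degZero k C ⟶ endModule k C x :=
  (ModuleCat.ofHom (quotToEnd k x) :)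

theorem inclEnd_projEnd (x : C) : inclEnd k x ≫ projEnd k x = 𝟙 _ := by
  exact ModuleCat.hom_ext (quotToEnd_comp_endToQuot x)

theorem inclEnd_projEnd_ne {x y : C} (h : x ≠ y) : inclEnd k x ≫ projEnd k y = 0 := by
  refine ModuleCat.hom_ext (LinearMap.ext fun m => ?_)
  exact single_ne_left (Ne.symm h) _ _ (m : x ⟶ x)

variable (C) in
theorem sum_projEnd_inclEnd : ∑ x : C, projEnd k x ≫ inclEnd k x = 𝟙 (degZero k C) :=
  ModuleCat.hom_ext ((ModuleCat.hom_sum _ _).trans sum_endToQuot_comp_quotToEnd)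

variable {k}

/-- The comparison map from `⨁_y Ext*(A₀, C(y, y))` to the algebra of the Yoneda category. -/
def extToAlgebra : ExtModule k C (degZero k C) →ₗ[YonedaAlgebra k C] YonedaAlgebra k C where
  toFun f := .mk k C fun x y => extPre k C (Ext.mk₀ (inclEnd k x)) y (f y)
  map_add' f g := by
    ext1 x y
    exact map_add _ _ _
  map_smul' e f := by
    ext1 x z
    rw [RingHom.id_apply, smul_eq_mul, YonedaAlgebra.app_mul]
    change extPre k C _ z ((e • f) z) = _
    rw [ExtModule.algebra_smul_apply, map_sum]
    exact Finset.sum_congr rfl fun y _ => extPre_extComp _ _ _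

theorem extToAlgebra_app (f : ExtModule k C (degZero k C)) (x y : C) :
    (extToAlgebra f).app x y = extPre k C (Ext.mk₀ (inclEnd k x)) y (f y) := rfl

variable (k C) in
/-- The generator of `⨁_y Ext*(A₀, C(y, y))`, given by the projections `A₀ → C(y, y)`. -/
def extGenerator : ExtModule k C (degZero k C) := fun y =>
  DirectSum.lof k ℕ (fun i => Ext.{u} (degZero k C) (endModule k C y) i) 0 (Ext.mk₀ (projEnd k y))

variable (k C) in
theorem extGenerator_mem : extGenerator k C ∈ ExtModule.homogeneous k C (degZero k C) 0 :=
  fun _ => ⟨_, rfl⟩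

theorem smul_extGenerator_apply (e : YonedaAlgebra k C) (y : C) :
    (e • extGenerator k C) y = ∑ x, extPre k C (Ext.mk₀ (projEnd k x)) y (e.app x y) :=
  Finset.sum_congr rfl fun x _ => extComp_mk₀ (projEnd k x) (e.app x y)

theorem extToAlgebra_extGenerator : extToAlgebra (extGenerator k C) = 1 := by
  ext1 x y
  rw [extToAlgebra_app, extGenerator, extPre_lof _ (zero_add 0), Ext.mk₀_comp_mk₀]
  by_cases h : x = y
  · subst h
    rw [inclEnd_projEnd, YonedaAlgebra.app_one_self]
    rfl
  · rw [inclEnd_projEnd_ne k h, YonedaAlgebra.app_one_ne h, Ext.mk₀_zero, map_zero]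

/-- The identity of `A₀` is the sum of its projections onto the summands `C(x, x)`. With
`extToAlgebra_extGenerator` this makes the `Ext` module of `A₀` free of rank one over `E`. -/
theorem extToAlgebra_smul_extGenerator (f : ExtModule k C (degZero k C)) :
    extToAlgebra f • extGenerator k C = f := by
  ext1 y
  rw [smul_extGenerator_apply]
  have h1 : ∀ x, extPre k C (Ext.mk₀ (projEnd k x)) y ((extToAlgebra f).app x y) =
      extPre k C (Ext.mk₀ (projEnd k x ≫ inclEnd k x)) y (f y) := by
    intro x
    rw [extToAlgebra_app, extPre_extPre _ _ (zero_add 0), Ext.mk₀_comp_mk₀]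
  rw [Finset.sum_congr rfl fun x _ => h1 x, ← extPre_sum, ← Ext.mk₀_sum, sum_projEnd_inclEnd,
    extPre_id]

theorem extToAlgebra_mem {n : ℕ} {f : ExtModule k C (degZero k C)}
    (hf : f ∈ ExtModule.homogeneous k C (degZero k C) n) :
    extToAlgebra f ∈ grading k (YonedaCategory k C) n := by
  rw [YonedaAlgebra.mem_grading]
  intro x y
  obtain ⟨g, hg⟩ := hf y
  rw [extToAlgebra_app, ← hg, extPre_lof _ (zero_add n)]
  exact ⟨_, rfl⟩

theorem inAdd_extModule_degZero :
    InAdd (A := YonedaAlgebra k C) (YonedaAlgebra k C) (ExtModule k C (degZero k C)) :=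
  .of_retract extToAlgebra (LinearMap.toSpanSingleton _ _ (extGenerator k C)) <| by
    ext1 f
    exact extToAlgebra_smul_extGenerator f

section Coordinates

variable {X : ModuleCat.{u} (CatAlgebra C)}

/-- The coordinate on `ExtModule k C X` given by a homomorphism `A₀ → X`. -/
def extCoord (p : degZero k C ⟶ X) :
    ExtModule k C X →ₗ[YonedaAlgebra k C] YonedaAlgebra k C :=
  extToAlgebra ∘ₗ ExtModule.pre k (Ext.mk₀ p)

/-- The degree zero element of `ExtModule k C X` given by a homomorphism `X → A₀`. -/
def extVector (s : X ⟶ degZero k C) : ExtModule k C X :=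
  ExtModule.pre k (Ext.mk₀ s) (extGenerator k C)

theorem extVector_mem (s : X ⟶ degZero k C) : extVector s ∈ ExtModule.homogeneous k C X 0 :=
  ExtModule.pre_mem_homogeneous (k := k) (C := C) (n := 0) (Ext.mk₀ s) (extGenerator_mem k C)

theorem extCoord_mem (p : degZero k C ⟶ X) {n : ℕ} {f : ExtModule k C X}
    (hf : f ∈ ExtModule.homogeneous k C X n) :
    extCoord p f ∈ grading k (YonedaCategory k C) n := by
  have := ExtModule.pre_mem_homogeneous (Ext.mk₀ p) hf
  rw [zero_add] at this
  exact extToAlgebra_mem this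

theorem extCoord_smul_extVector (p : degZero k C ⟶ X) (s : X ⟶ degZero k C)
    (f : ExtModule k C X) :
    extCoord p f • extVector s =
      ExtModule.pre k (Ext.mk₀ s) (ExtModule.pre k (Ext.mk₀ p) f) :=
  ((ExtModule.pre k (Ext.mk₀ s)).map_smul _ _).symm.trans
    (congrArg (ExtModule.pre k (Ext.mk₀ s))
      (extToAlgebra_smul_extGenerator (k := k) (C := C) (ExtModule.pre k (Ext.mk₀ p) f)))

/-- The `ExtModule` of a summand of a power of `A₀` is generated in degree zero. -/
theorem span_homogeneous_zero
    (h : InAdd (A := CatAlgebra C) (CatAlgebra C ⧸ positiveIdeal (grading k C)) X) :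
    ∃ (r : ℕ)
      (a : Fin r → ExtModule k C X →ₗ[YonedaAlgebra k C] YonedaAlgebra k C)
      (b : Fin r → ExtModule k C X),
      (∀ j, b j ∈ ExtModule.homogeneous k C X 0) ∧
      (∀ j n f, f ∈ ExtModule.homogeneous k C X n →
        a j f ∈ grading k (YonedaCategory k C) n) ∧ ∀ f, ∑ j, a j f • b j = f := by
  obtain ⟨r, s, p, h⟩ := h
  refine ⟨r, fun j => extCoord (ModuleCat.ofHom (p j)), fun j => extVector (ModuleCat.ofHom (s j)),
    fun j => extVector_mem _, fun j n f hf => extCoord_mem _ hf, fun f => ?_⟩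
  exact (Finset.sum_congr rfl fun j _ => extCoord_smul_extVector _ _ _).trans (sum_pre_pre h f)

end Coordinates

end RegularModule

/-! ### Degree zero part, order and skeletality of the Yoneda category. -/

section YonedaDirected

open Abelian CatAlgebra

variable {k : Type w} [Field k] {C : Type u} [Fintype C] [PartialOrder C] [Category.{u} C]
  [Preadditive C] [Linear k C] [IsDirectedCategory k C]

theorem decompose_zero_app (e : YonedaAlgebra k C) (x y : C) :
    YonedaAlgebra.app (k := k) (C := C)
        (DirectSum.decompose (grading k (YonedaCategory k C)) e 0 : YonedaAlgebra k C) x y =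
      DirectSum.lof k ℕ (fun i => Ext.{u} (endModule k C x) (endModule k C y) i) 0
        (e.app x y 0) := by
  induction e using DirectSum.Decomposition.inductionOn (grading k (YonedaCategory k C)) with
  | zero =>
    rw [DirectSum.decompose_zero, DirectSum.zero_apply, Submodule.coe_zero, YonedaAlgebra.app_zero,
      DirectSum.zero_apply, map_zero]
  | add a b ha hb =>
    rw [DirectSum.decompose_add, DirectSum.add_apply, Submodule.coe_add, YonedaAlgebra.app_add,
      ha, hb, YonedaAlgebra.app_add, DirectSum.add_apply, map_add]
  | homogeneous a =>
    rename_i n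
    obtain ⟨g, hg⟩ := YonedaAlgebra.mem_grading.mp a.2 x y
    by_cases hn : n = 0
    · subst hn
      rw [DirectSum.decompose_of_mem_same _ a.2, ← hg, DirectSum.lof_apply]
    · have h0 : (DirectSum.lof k ℕ
          (fun i => Ext.{u} (endModule k C x) (endModule k C y) i) n g) 0 = 0 :=
        DirectSum.of_eq_of_ne _ _ _ (Ne.symm hn)
      rw [DirectSum.decompose_of_mem_ne _ a.2 hn, ← hg, h0, map_zero, YonedaAlgebra.app_zero]

theorem mem_positiveIdeal_yoneda {e : YonedaAlgebra k C} :
    e ∈ positiveIdeal (grading k (YonedaCategory k C)) ↔ ∀ x y, e.app x y 0 = 0 := by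
  rw [mem_positiveIdeal]
  constructor
  · intro h x y
    have := decompose_zero_app e x y
    rw [h, YonedaAlgebra.app_zero] at this
    have h2 := congrArg (fun v : YonedaHom k C x y => v 0) this
    simp only [DirectSum.lof_apply] at h2
    exact h2.symm
  · intro h
    ext1 x y
    rw [decompose_zero_app, h, map_zero, YonedaAlgebra.app_zero]

theorem yoneda_hom_ne_zero {x y : C} (f : YonedaHom k C x y) (h : f ≠ 0) : x ≤ y := by
  by_contra hxy
  exact h (DFinsupp.ext fun n => ext_endModule_eq_zero_of_not_le k hxy (f n))

theorem id_eq_zero_of_yonedaId_eq_zero {x : C} (h : yonedaId k C x = 0) : 𝟙 x = 0 := by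
  have h2 := congrArg (fun v : YonedaHom k C x x => v 0) h
  simp only [yonedaId, DirectSum.lof_apply] at h2
  have h3 := (Ext.mk₀_eq_zero_iff _).mp h2
  exact LinearMap.congr_fun (congrArg ModuleCat.Hom.hom h3) (𝟙 x : x ⟶ x)

-- For inverse maps between distinct objects, antisymmetry makes one of them zero, so both
-- identities vanish, first in `E` and then in `C`. Both objects are then zero objects of `C`,
-- isomorphic through zero maps, against skeletality of `C`.
variable (k C) in
theorem yoneda_skeletal : Skeletal (YonedaCategory k C) := by
  have key : ∀ (x y : C) (f : YonedaHom k C x y) (g : YonedaHom k C y x),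
      yonedaComp k C x y x f g = yonedaId k C x → yonedaComp k C y x y g f = yonedaId k C y →
        x = y := by
    intro x y f g hfg hgf
    by_contra hxy
    have hzero : yonedaId k C x = 0 ∧ yonedaId k C y = 0 := by
      by_cases hf : f = 0
      · rw [← hfg, ← hgf, hf, map_zero, map_zero]
        exact ⟨rfl, rfl⟩
      · have hg : g = 0 := by
          by_contra hg
          exact hxy (le_antisymm (yoneda_hom_ne_zero f hf) (yoneda_hom_ne_zero g hg))
        rw [← hfg, ← hgf, hg, map_zero, map_zero]
        exact ⟨rfl, rfl⟩
    have hx := id_eq_zero_of_yonedaId_eq_zero hzero.1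
    have hy := id_eq_zero_of_yonedaId_eq_zero hzero.2
    refine hxy (IsDirectedCategory.skeletal (k := k) (C := C) ⟨⟨0, 0, ?_, ?_⟩⟩)
    · rw [Limits.zero_comp, hx]
    · rw [Limits.zero_comp, hy]
  rintro x y ⟨i⟩
  exact key x y i.hom i.inv i.hom_inv_id i.inv_hom_id

theorem yonedaHom_self_mem_range {x : C} (f : YonedaHom k C x x) :
    f ∈ LinearMap.range (DirectSum.lof k ℕ
      (fun i => Ext.{u} (endModule k C x) (endModule k C x) i) 0) := by
  refine ⟨f 0, (ExtModule.eq_lof_of_forall_ne fun m hm => ?_).symm⟩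
  obtain ⟨n, rfl⟩ := Nat.exists_eq_succ_of_ne_zero hm
  exact ext_succ_endModule_self_eq_zero k x (f (n + 1))

theorem yonedaHom_eq_zero_of_mem_range {x y : C} (h : x ≠ y) {f : YonedaHom k C x y}
    (hf : f ∈ LinearMap.range (DirectSum.lof k ℕ
      (fun i => Ext.{u} (endModule k C x) (endModule k C y) i) 0)) : f = 0 := by
  obtain ⟨g, rfl⟩ := hf
  rw [ext_zero_endModule_eq_zero k h g, map_zero]

theorem single_mem_grading {D : Type u} [Fintype D] [Category.{u} D] [Preadditive D] [Linear k D]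
    [GradedCategory k D] {x y : D} {n : ℕ} {f : x ⟶ y}
    (hf : f ∈ GradedCategory.deg (k := k) x y n) :
    single x y f ∈ grading k D n := by
  intro x' y'
  by_cases hx : x' = x
  · subst hx
    by_cases hy : y' = y
    · subst hy
      rwa [single_same]
    · rw [single_ne_right hy]
      exact zero_mem _
  · rw [single_ne_left hx]
    exact zero_mem _

end YonedaDirected

/-! ### Local finiteness of the `Ext` modules and of `E`. -/

section KoszulDual

open Abelian CatAlgebra

variable {k : Type w} [Field k] {C : Type u} [Fintype C] [PartialOrder C] [Category.{u} C]
  [Preadditive C] [Linear k C]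

section Finiteness

variable [IsDirectedCategory k C]

variable (k C) in
theorem finite_catAlgebra : Module.Finite k (CatAlgebra C) := by
  have := IsDirectedCategory.finite (k := k) (C := C)
  exact inferInstanceAs (Module.Finite k (∀ x y : C, (x ⟶ y)))

variable (k) in
theorem finite_endModule (x : C) : Module.Finite (CatAlgebra C) (endModule k C x) :=
  .of_surjective (toEndModule k x) fun m => ⟨single x x m, single_same x x m⟩

variable (k) in
theorem finite_ext_endModule (X : ModuleCat.{u} (CatAlgebra C)) [Module.Finite (CatAlgebra C) X]
    (y : C) (n : ℕ) : Module.Finite k (Ext.{u} X (endModule k C y) n) := by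
  have := finite_catAlgebra k C
  have := finite_endModule k y
  exact finite_ext k X _ n

theorem ExtModule.finite_homogeneous (X : ModuleCat.{u} (CatAlgebra C))
    [Module.Finite (CatAlgebra C) X] (n : ℕ) :
    Module.Finite k (ExtModule.homogeneous k C X n) := by
  have := fun y => finite_ext_endModule k X y n
  let φ : ExtModule.homogeneous k C X n →ₗ[k] ∀ y : C, Ext.{u} X (endModule k C y) n :=
    { toFun := fun f y => f.1 y n
      map_add' := fun _ _ => rfl
      map_smul' := fun _ _ => rfl }
  refine Module.Finite.of_injective φ ((injective_iff_map_eq_zero φ).mpr fun f hf => ?_)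
  apply Subtype.ext
  ext1 y
  obtain ⟨g, hg⟩ := f.2 y
  have h0 : f.1 y n = 0 := congrFun hf y
  rw [← hg, DirectSum.lof_apply] at h0
  rw [← hg, h0, map_zero]
  rfl

theorem ExtModule.graded_isLocallyFinite (X : ModuleCat.{u} (CatAlgebra C))
    [Module.Finite (CatAlgebra C) X] (s : ℤ) :
    (ExtModule.graded k C X s).IsLocallyFinite := by
  intro j
  by_cases h : j < s
  · have : (ExtModule.graded k C X s).deg j = ⊥ :=
      (Submodule.eq_bot_iff _).mpr fun f hf => ExtModule.eq_zero_of_mem_shiftedDeg_of_lt h hf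
    rw [this]
    infer_instance
  · obtain ⟨n, rfl⟩ : ∃ n : ℕ, j = n + s := ⟨(j - s).toNat, by omega⟩
    have : (ExtModule.graded k C X s).deg (n + s) = ExtModule.homogeneous k C X n :=
      Submodule.ext fun f => ExtModule.mem_shiftedDeg_add
    rw [this]
    exact ExtModule.finite_homogeneous X n

theorem finite_grading_yoneda (n : ℕ) :
    Module.Finite k (grading k (YonedaCategory k C) n) := by
  have h1 : ∀ x y : C, Module.Finite k (Ext.{u} (endModule k C x) (endModule k C y) n) :=
    fun x y => by
      have := finite_endModule k x
      exact finite_ext_endModule k _ y n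
  let φ : grading k (YonedaCategory k C) n →ₗ[k]
      ∀ x y : C, Ext.{u} (endModule k C x) (endModule k C y) n :=
    { toFun := fun e x y => YonedaAlgebra.app e.1 x y n
      map_add' := fun _ _ => rfl
      map_smul' := fun _ _ => rfl }
  refine Module.Finite.of_injective φ ((injective_iff_map_eq_zero φ).mpr fun f hf => ?_)
  apply Subtype.ext
  refine YonedaAlgebra.ext fun x y => ?_
  obtain ⟨g, hg⟩ := YonedaAlgebra.mem_grading.mp f.2 x y
  have h0 : YonedaAlgebra.app f.1 x y n = 0 := congrFun (congrFun hf x) y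
  rw [← hg, DirectSum.lof_apply] at h0
  rw [← hg, h0, map_zero]
  rfl

end Finiteness

end KoszulDual

/-! ### A height function on a finite partial order. -/

section NumBelow

variable {D : Type u} [Fintype D] [PartialOrder D]

open Classical in
/-- The number of objects below `x`. -/
def numBelow (x : D) : ℕ := (Finset.univ.filter (· < x)).card

theorem numBelow_mono {x y : D} (h : x ≤ y) : numBelow x ≤ numBelow y := by
  classical
  exact Finset.card_le_card fun z hz => by simpa using lt_of_lt_of_le (by simpa using hz) h

theorem numBelow_strictMono {x y : D} (h : x < y) : numBelow x < numBelow y := by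
  classical
  refine Finset.card_lt_card (Finset.ssubset_iff.mpr ⟨x, by simp, fun z hz => ?_⟩)
  rcases Finset.mem_insert.mp hz with rfl | hz
  · simpa using h
  · simpa using lt_trans (by simpa using hz) h

theorem numBelow_le (x : D) : numBelow x ≤ Fintype.card D := Finset.card_le_univ _

end NumBelow

/-! ### Generation of `E` in degrees zero and one, and directedness. -/

section KoszulDual

open Abelian CatAlgebra

variable {k : Type w} [Field k] {C : Type u} [Fintype C] [PartialOrder C] [Category.{u} C]
  [Preadditive C] [Linear k C] [GradedCategory k C] [IsGradedDirectedCategory k C]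

section Coordinates

variable {X : ModuleCat.{u} (CatAlgebra C)}

theorem pre_mk₀_pre_mk₀ {Y Z : ModuleCat.{u} (CatAlgebra C)} (p : X ⟶ Y) (s : Y ⟶ Z)
    (f : ExtModule k C Z) :
    ExtModule.pre k (Ext.mk₀ p) (ExtModule.pre k (Ext.mk₀ s) f) =
      ExtModule.pre k (Ext.mk₀ (p ≫ s)) f := by
  ext1 y
  refine (extPre_extPre _ _ (zero_add 0) _).trans ?_
  rw [Ext.mk₀_comp_mk₀]
  rfl

theorem pre_mk₀_id (f : ExtModule k C X) : ExtModule.pre k (Ext.mk₀ (𝟙 X)) f = f :=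
  ExtModule.ext fun _ => extPre_id _

theorem extCoord_smul_extVector_eq {p : degZero k C ⟶ X} {s : X ⟶ degZero k C} (h : p ≫ s = 𝟙 _)
    (e : YonedaAlgebra k C) : extCoord p (e • extVector s) = e := by
  have h1 : extCoord p (extVector s) = 1 := by
    change extToAlgebra (ExtModule.pre k (Ext.mk₀ p)
      (ExtModule.pre k (Ext.mk₀ s) (extGenerator k C))) = 1
    rw [pre_mk₀_pre_mk₀, h, pre_mk₀_id, extToAlgebra_extGenerator]
  rw [map_smul, h1, smul_eq_mul, mul_one]

theorem extCoord_smul_extVector_eq_self {p : degZero k C ⟶ X} {s : X ⟶ degZero k C}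
    (h : s ≫ p = 𝟙 _) (f : ExtModule k C X) : extCoord p f • extVector s = f := by
  rw [extCoord_smul_extVector, pre_mk₀_pre_mk₀, h, pre_mk₀_id]

/-- Precomposition with degree zero classes preserves the `Ext` degree, so `Ext⁰` components
correspond; by `h` the element `f` is recovered from its coordinate. -/
theorem extCoord_mem_positiveIdeal_iff {p : degZero k C ⟶ X} {s : X ⟶ degZero k C}
    (h : s ≫ p = 𝟙 _) {f : ExtModule k C X} :
    extCoord p f ∈ positiveIdeal (grading k (YonedaCategory k C)) ↔ ∀ y, f y 0 = 0 := by
  rw [mem_positiveIdeal_yoneda]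
  constructor
  · intro hf y
    rw [← extCoord_smul_extVector_eq_self h f]
    have h1 : extCoord p f • extVector s =
        ExtModule.pre k (Ext.mk₀ s) (extCoord p f • extGenerator k C) :=
      ((ExtModule.pre k (Ext.mk₀ s)).map_smul _ _).symm
    rw [h1, ExtModule.pre_apply, extPre_apply_add _ _ (zero_add 0), smul_extGenerator_apply]
    have h2 : (∑ x, extPre k C (Ext.mk₀ (projEnd k x)) y ((extCoord p f).app x y)) 0 = 0 := by
      rw [DFinsupp.finsetSum_apply]
      refine Finset.sum_eq_zero fun x _ => ?_
      rw [extPre_apply_add _ _ (zero_add 0), hf, Ext.comp_zero]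
    rw [h2, Ext.comp_zero]
  · intro hf x y
    have h1 : (extCoord p f).app x y =
      extPre k C (Ext.mk₀ (inclEnd k x)) y (extPre k C (Ext.mk₀ p) y (f y)) := rfl
    rw [h1, extPre_apply_add _ _ (zero_add 0), extPre_apply_add _ _ (zero_add 0), hf,
      Ext.comp_zero, Ext.comp_zero]

end Coordinates

variable (k C) in
/-- The module `Jⁱ / Jⁱ⁺¹`. -/
abbrev grModule (i : ℕ) : ModuleCat.{u} (CatAlgebra C) :=
  ModuleCat.of (CatAlgebra C) (Gr (positiveIdeal (grading k C)) (CatAlgebra C) i)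

variable (k C) in
/-- The isomorphism of `A₀` with `J⁰ / J¹`. -/
def grZeroHom : degZero k C ⟶ grModule k C 0 :=
  ModuleCat.ofHom (LinearResolution.grZeroEquiv (positiveIdeal_isTwoSided _)).toLinearMap

variable (k C) in
/-- The isomorphism of `J⁰ / J¹` with `A₀`. -/
def grZeroInv : grModule k C 0 ⟶ degZero k C :=
  ModuleCat.ofHom (LinearResolution.grZeroEquiv (positiveIdeal_isTwoSided _)).symm.toLinearMap

omit [PartialOrder C] [IsGradedDirectedCategory k C] in
theorem grZeroHom_inv : grZeroHom k C ≫ grZeroInv k C = 𝟙 _ :=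
  ModuleCat.hom_ext (LinearMap.ext fun x => LinearEquiv.symm_apply_apply
    (LinearResolution.grZeroEquiv (positiveIdeal_isTwoSided (grading k C))) x)

omit [PartialOrder C] [IsGradedDirectedCategory k C] in
theorem grZeroInv_hom : grZeroInv k C ≫ grZeroHom k C = 𝟙 _ :=
  ModuleCat.hom_ext (LinearMap.ext fun x => LinearEquiv.apply_symm_apply
    (LinearResolution.grZeroEquiv (positiveIdeal_isTwoSided (grading k C))) x)

variable (k C) in
/-- The extension class of `Jⁱ / Jⁱ⁺²`. -/
abbrev grModuleClass (i : ℕ) : Ext.{u} (grModule k C i) (grModule k C (i + 1)) 1 :=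
  grClass (positiveIdeal (grading k C)) i

variable (k C) in
/-- The consequences of linearity of the projective resolution of `A₀` and self-injectivity of the
algebra `A₀` which enter in the construction of the resolution over the Yoneda algebra. -/
structure HasLinearGr : Prop where
  inAdd (i : ℕ) : InAdd (A := CatAlgebra C) (CatAlgebra C ⧸ positiveIdeal (grading k C))
    (Gr (positiveIdeal (grading k C)) (CatAlgebra C) i)
  pull_eq_zero (y : C) (n i : ℕ) (e : Ext.{u}
    (ModuleCat.of (CatAlgebra C) (filt (positiveIdeal (grading k C)) (CatAlgebra C) i))
      (endModule k C y) n) :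
    pull (Submodule.inclusion (filt_succ_le (positiveIdeal (grading k C)) i)) e = 0

/-- Koszulness and self-injectivity of `C` enter only here; the rest of the argument knows them
through `HasLinearGr`. Directedness supplies that `J` has no nonzero idempotents. -/
theorem IsKoszulCategory.hasLinearGr (hK : IsKoszulCategory k C)
    (hI : IsSelfInjective (grading k C 0)) : HasLinearGr k C := by
  obtain ⟨R⟩ := IsKoszulAlgebra.exists_linearResolution hK fun a ha h => eq_zero_of_mul_self_eq ha h
  have hI' := isRelInjective_of_isSelfInjective hI
  exact ⟨LinearResolution.inAdd_gr R (positiveIdeal_isTwoSided _) hI', fun y n i e =>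
    LinearResolution.pull_filt_eq_zero R (positiveIdeal_isTwoSided _) hI' (isKilled_endModule y)
      n i e⟩

theorem HasLinearGr.exists_pre_eq (H : HasLinearGr k C) {n : ℕ}
    {f : ExtModule k C (grModule k C 0)}
    (hf : f ∈ ExtModule.homogeneous k C (grModule k C 0) (n + 1)) :
    ∃ v ∈ ExtModule.homogeneous k C (grModule k C (0 + 1)) n,
      ExtModule.pre k (grModuleClass k C 0) v = f := by
  choose g hg using hf
  choose g' hg' using fun y => exists_grClass_zero_comp (g y) (H.pull_eq_zero y)
  refine ⟨fun y => DirectSum.lof k ℕ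
    (fun i => Ext.{u} (grModule k C (0 + 1)) (endModule k C y) i) n (g' y), fun y => ⟨_, rfl⟩,
    ExtModule.ext fun y => ?_⟩
  rw [← hg]
  exact (extPre_lof (grModuleClass k C 0) (add_comm 1 n) (g' y)).trans (congrArg _ (hg' y))

/-- View `a` in `E ≅ Ext*(J⁰ / J¹, A₀)`. Having degree `n + 1`, it is the image of some `v` in the
degree `n` part for `J / J²`. That module is generated in degree zero, so `v` has coefficients in
`Eₙ`, and the linear map to `E` sends the generators into `E₁`. -/
theorem HasLinearGr.grading_succ_le (H : HasLinearGr k C) (n : ℕ) :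
    grading k (YonedaCategory k C) (n + 1) ≤
      grading k (YonedaCategory k C) n * grading k (YonedaCategory k C) 1 := by
  intro a ha
  have hf := ExtModule.smul_mem_homogeneous ha (extVector_mem (k := k) (grZeroInv k C))
  rw [add_zero] at hf
  obtain ⟨v, hv, hvf⟩ := H.exists_pre_eq hf
  obtain ⟨r, c, b, hb, hc, hcb⟩ :=
    span_homogeneous_zero (k := k) (X := grModule k C (0 + 1)) (H.inAdd (0 + 1))
  let φ : ExtModule k C (grModule k C (0 + 1)) →ₗ[YonedaAlgebra k C] YonedaAlgebra k C :=
    extCoord (grZeroHom k C) ∘ₗ ExtModule.pre k (grModuleClass k C 0)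
  have h1 : φ v = a := by
    change extCoord (grZeroHom k C) (ExtModule.pre k (grModuleClass k C 0) v) = a
    rw [hvf]
    exact extCoord_smul_extVector_eq (grZeroHom_inv (k := k)) a
  have h2 : φ v = ∑ j, c j v * φ (b j) := by
    conv_lhs => rw [← hcb v]
    rw [map_sum]
    exact Finset.sum_congr rfl fun j _ => φ.map_smul _ _
  have h3 : ∀ j, φ (b j) ∈ grading k (YonedaCategory k C) 1 := fun j => by
    have h4 := ExtModule.pre_mem_homogeneous (k := k) (grModuleClass k C 0) (hb j)
    rw [add_zero] at h4
    exact extCoord_mem (k := k) (grZeroHom k C) h4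
  rw [← h1, h2]
  exact Submodule.sum_mem _ fun j _ => Submodule.mul_mem_mul (hc j n v hv) (h3 j)

theorem HasLinearGr.grading_mul (H : HasLinearGr k C) (i j : ℕ) :
    grading k (YonedaCategory k C) i * grading k (YonedaCategory k C) j =
      grading k (YonedaCategory k C) (i + j) := by
  refine le_antisymm (Submodule.mul_le.mpr fun a ha b hb => SetLike.mul_mem_graded ha hb) ?_
  induction j with
  | zero =>
    intro a ha
    rw [← mul_one a]
    exact Submodule.mul_mem_mul ha (SetLike.one_mem_graded _)
  | succ j ih =>
    refine (H.grading_succ_le (i + j)).trans ((mul_le_mul' ih le_rfl).trans ?_)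
    rw [mul_assoc]
    exact mul_le_mul' le_rfl
      (Submodule.mul_le.mpr fun a ha b hb => SetLike.mul_mem_graded ha hb)

section Vanishing

/-- A class of degree `n` is a sum of products with `n` factors of degree one, and each such factor
goes strictly up, as `C(x, x)` has no self-extensions. -/
theorem HasLinearGr.add_numBelow_le (H : HasLinearGr k C) {n : ℕ} {e : YonedaAlgebra k C}
    (he : e ∈ grading k (YonedaCategory k C) n) {x y : C} (h : e.app x y ≠ 0) :
    numBelow x + n ≤ numBelow y := by
  induction n generalizing e x y with
  | zero => exact numBelow_mono (yoneda_hom_ne_zero _ h)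
  | succ n ih =>
    replace he := H.grading_succ_le n he
    induction he using Submodule.mul_induction_on' with
    | mem_mul_mem a ha b hb =>
      rw [YonedaAlgebra.app_mul] at h
      obtain ⟨z, -, hz⟩ := Finset.exists_ne_zero_of_sum_ne_zero h
      have ha0 : a.app z y ≠ 0 := fun h0 => hz (by rw [h0, map_zero])
      have hb0 : b.app x z ≠ 0 := fun h0 => hz (by rw [h0, LinearMap.map_zero₂])
      have hxz : x ≠ z := by
        rintro rfl
        obtain ⟨g, hg⟩ := YonedaAlgebra.mem_grading.mp hb x x
        rw [← hg, ext_succ_endModule_self_eq_zero k x g, map_zero] at hb0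
        exact hb0 rfl
      have h1 := numBelow_strictMono (lt_of_le_of_ne (yoneda_hom_ne_zero _ hb0) hxz)
      have h2 := ih ha ha0
      omega
    | add a _ b _ iha ihb =>
      by_cases ha0 : a.app x y = 0
      · exact ihb fun hb0 => h (by rw [YonedaAlgebra.app_add, ha0, hb0, add_zero])
      · exact iha ha0

theorem HasLinearGr.ext_eq_zero (H : HasLinearGr k C) {x y : C} {n : ℕ} (hn : Fintype.card C < n)
    (f : Ext.{u} (endModule k C x) (endModule k C y) n) : f = 0 := by
  by_contra hf
  let v : YonedaHom k C x y := DirectSum.lof k ℕ _ n f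
  let e : YonedaAlgebra k C := single (C := YonedaCategory k C) x y v
  have he : e ∈ grading k (YonedaCategory k C) n :=
    single_mem_grading (D := YonedaCategory k C) ⟨f, rfl⟩
  have hev : e.app x y = v := single_same (C := YonedaCategory k C) x y v
  have hv : v ≠ 0 := fun h0 => hf <| by
    have := congrArg (fun w : YonedaHom k C x y => w n) h0
    exact (DirectSum.lof_apply k n f).symm.trans this
  have := H.add_numBelow_le he (x := x) (y := y) (by rwa [hev])
  have := numBelow_le y
  omega

theorem HasLinearGr.finite_yonedaHom (H : HasLinearGr k C) (x y : C) :
    Module.Finite k (YonedaHom k C x y) := by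
  have := finite_endModule k x
  have : ∀ n, Module.Finite k (Ext.{u} (endModule k C x) (endModule k C y) n) :=
    finite_ext_endModule k (endModule k C x) y
  let φ : YonedaHom k C x y →ₗ[k]
      ∀ n : Fin (Fintype.card C + 1), Ext.{u} (endModule k C x) (endModule k C y) n :=
    { toFun := fun f n => f n
      map_add' := fun _ _ => rfl
      map_smul' := fun _ _ => rfl }
  refine Module.Finite.of_injective φ ((injective_iff_map_eq_zero φ).mpr fun f hf => ?_)
  refine DFinsupp.ext fun n => ?_
  by_cases hn : n < Fintype.card C + 1
  · exact congrFun hf ⟨n, hn⟩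
  · exact H.ext_eq_zero (by omega) (f n)

theorem HasLinearGr.isGradedDirectedCategory (H : HasLinearGr k C) :
    IsGradedDirectedCategory k (YonedaCategory k C) where
  skeletal := yoneda_skeletal k C
  finite := H.finite_yonedaHom
  le_of_hom_ne_zero f hf := yoneda_hom_ne_zero (k := k) (C := C) f hf
  deg_zero_end x := by
    rw [eq_top_iff]
    exact fun f _ => yonedaHom_self_mem_range (k := k) (C := C) f
  deg_zero_ne x y h := by
    rw [eq_bot_iff]
    exact fun f hf => yonedaHom_eq_zero_of_mem_range (k := k) (C := C) h hf

end Vanishing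

end KoszulDual

theorem InAdd.finite {R X Y : Type u} [Ring R] [AddCommGroup X] [Module R X] [AddCommGroup Y]
    [Module R Y] [Module.Finite R Y] (h : InAdd (A := R) Y X) : Module.Finite R X := by
  obtain ⟨r, s, p, h⟩ := h
  refine .of_surjective (∑ j, p j ∘ₗ LinearMap.proj j : (Fin r → Y) →ₗ[R] X) fun x =>
    ⟨fun j => s j x, ?_⟩
  have := LinearMap.congr_fun h x
  simpa using this

theorem degreeZeroModule_isGeneratedIn {k : Type w} [Field k] {A : Type u} [Ring A] [Algebra k A]
    (𝒜 : ℕ → Submodule k A) [GradedAlgebra 𝒜] : (degreeZeroModule 𝒜).IsGeneratedIn 0 :=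
  (Submodule.eq_top_iff').mpr fun x => Submodule.subset_span (mem_degreeZeroModule_deg x)

/-! ### The linear projective resolution of `E₀`. -/

section KoszulResolution

open Abelian CatAlgebra

variable {k : Type w} [Field k] {C : Type u} [Fintype C] [PartialOrder C] [Category.{u} C]
  [Preadditive C] [Linear k C]

section Grading

variable [IsDirectedCategory k C] {X Y : ModuleCat.{u} (CatAlgebra C)}

/-- Composition with a class in `Ext¹` raises the `Ext` degree by one, which the drop of the shift
from `t` to `s` compensates. -/
theorem ExtModule.isGradedHom_pre (α : Ext.{u} X Y 1) {s t : ℤ} (h : s + 1 = t) :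
    GrModule.IsGradedHom (M := ExtModule.graded k C Y t) (N := ExtModule.graded k C X s)
      (ExtModule.pre k α) := by
  intro j f hf
  change f ∈ ExtModule.shiftedDeg k C Y t j at hf
  change ExtModule.pre k α f ∈ ExtModule.shiftedDeg k C X s j
  by_cases hj : j < t
  · rw [ExtModule.eq_zero_of_mem_shiftedDeg_of_lt hj hf, map_zero]
    exact zero_mem _
  · obtain ⟨n, rfl⟩ : ∃ n : ℕ, j = n + t := ⟨(j - t).toNat, by omega⟩
    have h1 := ExtModule.pre_mem_homogeneous α (ExtModule.mem_shiftedDeg_add.mp hf)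
    rw [← ExtModule.mem_shiftedDeg_add (s := s)] at h1
    have h2 : ((1 + n : ℕ) : ℤ) + s = n + t := by push_cast; omega
    rwa [h2] at h1

end Grading

variable [GradedCategory k C] [IsGradedDirectedCategory k C]

theorem ExtModule.isGeneratedIn {X : ModuleCat.{u} (CatAlgebra C)}
    (h : InAdd (A := CatAlgebra C) (CatAlgebra C ⧸ positiveIdeal (grading k C)) X) (s : ℤ) :
    (ExtModule.graded k C X s).IsGeneratedIn s := by
  obtain ⟨r, a, b, hb, -, hab⟩ := span_homogeneous_zero h
  refine (Submodule.eq_top_iff').mpr fun (f : ExtModule k C X) => ?_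
  rw [← hab f]
  refine Submodule.sum_mem _ fun j _ => Submodule.smul_mem _ _ (Submodule.subset_span ?_)
  have := (ExtModule.mem_shiftedDeg_add (s := s)).mpr (hb j)
  rwa [Nat.cast_zero, zero_add] at this

variable (k C) in
/-- The augmentation of the resolution of `E₀`. -/
def extAugmentation : ExtModule k C (grModule k C 0) →ₗ[YonedaAlgebra k C]
    (degreeZeroModule (grading k (YonedaCategory k C))).carrier :=
  toDegreeZero (grading k (YonedaCategory k C)) ∘ₗ extCoord (grZeroHom k C)

theorem extAugmentation_eq_zero_iff (f : ExtModule k C (grModule k C 0)) :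
    extAugmentation k C f = 0 ↔ ∀ y, f y 0 = 0 :=
  (toDegreeZero_eq_zero_iff (𝒜 := grading k (YonedaCategory k C))).trans
    (extCoord_mem_positiveIdeal_iff (grZeroInv_hom (k := k)))

theorem extAugmentation_surjective : Function.Surjective (extAugmentation k C) := by
  refine (toDegreeZero_surjective (𝒜 := grading k (YonedaCategory k C))).comp fun e =>
    ⟨e • extVector (grZeroInv k C), ?_⟩
  exact extCoord_smul_extVector_eq (grZeroHom_inv (k := k)) e

theorem isGradedHom_extAugmentation :
    GrModule.IsGradedHom (M := ExtModule.graded k C (grModule k C 0) ((0 : ℕ) : ℤ))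
      (extAugmentation k C) := by
  intro j f hf
  change f ∈ ExtModule.shiftedDeg k C (grModule k C 0) ((0 : ℕ) : ℤ) j at hf
  by_cases hj : j < ((0 : ℕ) : ℤ)
  · rw [ExtModule.eq_zero_of_mem_shiftedDeg_of_lt hj hf]
    exact (congrArg (· ∈ _) (map_zero (extAugmentation k C))).mpr (zero_mem _)
  · obtain ⟨n, rfl⟩ : ∃ n : ℕ, j = n + ((0 : ℕ) : ℤ) := ⟨j.toNat, by omega⟩
    have h1 := extCoord_mem (grZeroHom k C) (ExtModule.mem_shiftedDeg_add.mp hf)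
    by_cases hn : n = 0
    · subst hn
      exact mem_degreeZeroModule_deg _
    · have h2 : extAugmentation k C f = 0 :=
        toDegreeZero_eq_zero_iff.mpr (mem_positiveIdeal_of_mem _ h1 hn)
      exact (congrArg (· ∈ _) h2).mpr (zero_mem _)

variable (k C) in
/-- The differentials of the resolution of `E₀`. -/
abbrev extDifferential (i : ℕ) : ExtModule k C (grModule k C (i + 1)) →ₗ[YonedaAlgebra k C]
    ExtModule k C (grModule k C i) :=
  ExtModule.pre k (grModuleClass k C i)

theorem extDifferential_apply_zero {i : ℕ} (f : ExtModule k C (grModule k C (i + 1))) (y : C) :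
    extDifferential k C i f y 0 = 0 :=
  extPre_apply_of_lt _ _ one_pos

theorem extDifferential_apply_succ {i : ℕ} (f : ExtModule k C (grModule k C (i + 1))) (y : C)
    (n : ℕ) :
    extDifferential k C i f y (n + 1) = (grModuleClass k C i).comp (f y n) (add_comm 1 n) :=
  extPre_apply_add _ _ _

theorem HasLinearGr.exact_augmentation (H : HasLinearGr k C) :
    Function.Exact (extDifferential k C 0) (extAugmentation k C) := by
  intro f
  rw [extAugmentation_eq_zero_iff]
  constructor
  · intro hf
    exact ExtModule.exists_pre_eq _ f hf fun y n =>
      exists_grClass_zero_comp (f y (n + 1)) (H.pull_eq_zero y)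
  · rintro ⟨g, rfl⟩ y
    exact extDifferential_apply_zero g y

/-- In `Ext⁰` multiplication by the extension class is injective, so a cycle has no `Ext⁰`
component; its higher components lift by `exists_grClass_succ_comp`. -/
theorem HasLinearGr.exact_differential (H : HasLinearGr k C) (i : ℕ) :
    Function.Exact (extDifferential k C (i + 1)) (extDifferential k C i) := by
  intro f
  constructor
  · intro hf
    have h1 : ∀ y n, (grModuleClass k C i).comp (f y n) (add_comm 1 n) = 0 := fun y n => by
      rw [← extDifferential_apply_succ, hf]
      rfl
    exact ExtModule.exists_pre_eq _ f
      (fun y => grClass_comp_injective_zero (f y 0) (H.pull_eq_zero y) (h1 y 0)) fun y n =>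
      exists_grClass_succ_comp (f y (n + 1)) (H.pull_eq_zero y) (h1 y (n + 1))
  · rintro ⟨g, rfl⟩
    ext1 y
    refine DFinsupp.ext fun n => ?_
    -- Two differentials raise the degree by two, so nothing lands in degrees `0` and `1`; beyond
    -- that, consecutive extension classes have product zero.
    match n with
    | 0 => exact extDifferential_apply_zero _ y
    | 1 =>
      refine (extDifferential_apply_succ _ y 0).trans ?_
      rw [extDifferential_apply_zero, Ext.comp_zero]
      rfl
    | n + 2 =>
      refine (extDifferential_apply_succ _ y (n + 1)).trans ?_
      rw [extDifferential_apply_succ]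
      exact grClass_comp_grClass_comp _ _ _

/-- The shift by `i` on the `Ext` module of `Jⁱ / Jⁱ⁺¹` places its generators in degree `i` and
makes the differentials homogeneous of degree zero. -/
theorem HasLinearGr.isKoszulCategory (H : HasLinearGr k C) :
    IsKoszulCategory k (YonedaCategory k C) where
  locallyFinite := finite_grading_yoneda
  mul_eq := H.grading_mul
  koszul := by
    have := H.isGradedDirectedCategory
    have hE := finite_catAlgebra k (YonedaCategory k C)
    have hA := finite_catAlgebra k C
    have hfin : ∀ i, Module.Finite (CatAlgebra C) (grModule k C i) := fun i => (H.inAdd i).finite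
    refine ⟨fun i => ?_, degreeZeroModule_isGeneratedIn _,
      fun i => ExtModule.graded k C (grModule k C i) i, fun i => extDifferential k C i,
      extAugmentation k C, fun i => ?_, fun i => ExtModule.graded_isLocallyFinite _ _,
      fun i => ExtModule.isGeneratedIn (H.inAdd i) i,
      fun i => ExtModule.isGradedHom_pre _ (Nat.cast_succ i).symm,
      isGradedHom_extAugmentation, extAugmentation_surjective, H.exact_augmentation,
      H.exact_differential⟩
    · have : Module.Finite k (degreeZeroModule (grading k (YonedaCategory k C))).carrier :=
        Module.Finite.of_surjective
          ((toDegreeZero (grading k (YonedaCategory k C))).restrictScalars k)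
          toDegreeZero_surjective
      infer_instance
    · exact (inAdd_extModule_degZero.trans (H.inAdd i).extModule).projective

end KoszulResolution

end DirectedKoszul

end

theorem theorem5p10 {k : Type w} [Field k] [IsAlgClosed k] {C : Type u} [Fintype C]
    [PartialOrder C] [Category.{u} C] [Preadditive C] [Linear k C]
    [DirectedKoszul.GradedCategory k C] [DirectedKoszul.IsGradedDirectedCategory k C]
    (hK : DirectedKoszul.IsKoszulCategory k C)
    (hI : DirectedKoszul.IsSelfInjective (DirectedKoszul.CatAlgebra.grading k C 0)) :
    DirectedKoszul.IsGradedDirectedCategory k (DirectedKoszul.YonedaCategory k C) ∧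
      DirectedKoszul.IsKoszulCategory k (DirectedKoszul.YonedaCategory k C) := by
  have H := hK.hasLinearGr hI
  exact ⟨H.isGradedDirectedCategory, H.isKoszulCategory⟩
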